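/- Let $k$ be a field, $H$ a Hopf algebra over $k$ with coproduct $\Delta(h)=h_1\otimes h_2$, counit $\epsilon$ and antipode $S$, and let $A$ be a right $H$-comodule algebra with coaction $\Delta_A\colon A\to A\otimes H$, $\Delta_A(a)=a_0\otimes a_1$. Put $B=A^{\mathrm{co}H}=\{b\in A:\Delta_A(b)=b\otimes 1\}$, and assume that $B\subseteq A$ is a quantum principal bundle, i.e. the canonical map $\chi\colon A\otimes_BA\to A\otimes H$, $a\otimes_B a'\mapsto aa'_0\otimes a'_1$, is bijective and $A$ is a faithfully flat left $B$-module (a sequence $0\to X\to Y\to Z\to 0$ of right $B$-modules is short exact if and only if the sequence obtained by applying $-\otimes_BA$ is). Let $(\Gamma,\mathrm d)$ be a bicovariant first order differential calculus on $H$: $\Gamma$ is an $H$-bimodule spanned by the elements $a\,\mathrm db$, $\mathrm d$ is a $k$-linear derivation, and there are a left and a right $H$-coaction on $\Gamma$ that are compatible with the bimodule structure and for which $\mathrm d$ is colinear. Let $\Omega^\bullet(H)=\Gamma^\wedge$ be its maximal prolongation, the quotient of the tensor algebra $H\oplus\Gamma\oplus(\Gamma\otimes_H\Gamma)\oplus\cdots$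 by the ideal generated by all $\sum_i\mathrm da_i\otimes\mathrm db_i$ with $\sum_ia_i\,\mathrm db_i=0$, with its differential extending $\mathrm d$. The coproduct of $H$ and the left coaction on $\Gamma$ extend to an algebra map $\lambda\colon\Gamma^\wedge\to H\otimes\Gamma^\wedge$, $\lambda(\omega)=\omega_{-1}\otimes\omega_0$. Let $\Lambda^\bullet=\bigoplus_n\Lambda^n$, $\Lambda^n=\{\theta\in\Omega^n(H):\lambda(\theta)=1\otimes\theta\}$, $\pi_{inv}\colon\Gamma^\wedge\to\Lambda^\bullet$, $\pi_{inv}(\omega)=S(\omega_{-1})\omega_0$, $\varpi(h)=S(h_1)\mathrm dh_2$, $\pi_\epsilon(h)=h-\epsilon(h)1$ and $\theta\leftharpoonup h=S(h_1)\theta h_2$. A differential calculus over $A$ is a differential graded algebra $\Omega^\bullet$ over $k$ with $\Omega^0=A$ in which $\Omega^n$ is spanned by all $a^0\,\mathrm da^1\wedge\dots\wedge\mathrm da^n$ with $a^i\in A$. It is complete if $\Delta_A$ extends to a morphism $\Omega^\bullet\to\Omega^\bullet\otimes\Omega^\bullet(H)$ of differential graded algebras, where $\otimes$ is the graded tensor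 product. The vertical forms are $\mathfrak{ver}^\bullet(A)=A\otimes\Lambda^\bullet$, graded by $\mathfrak{ver}^n(A)=A\otimes\Lambda^n$, with $$(a\otimes\theta)\wedge(b\otimes\eta)=ab_0\otimes(\theta\leftharpoonup b_1)\wedge\eta,\qquad \mathrm d(a\otimes\theta)=a\otimes\mathrm d\theta+a_0\otimes\varpi(\pi_\epsilon(a_1))\wedge\theta,$$ and with $A$ included by $a\mapsto a\otimes1$. For a complete differential calculus $\Omega^\bullet(A)$ over $A$ with extension $\Delta_A^\wedge$ of $\Delta_A$, the vertical projection $\pi_{\mathfrak{ver}}\colon\Omega^\bullet(A)\to\mathfrak{ver}^\bullet(A)$ is given on $\Omega^n(A)$ by $(\mathrm{id}\otimes(\pi_{inv}\circ\pi_n))\circ\Delta_A^\wedge$, where $\pi_n\colon\Omega^\bullet(H)\to\Omega^n(H)$ is the projection, so that $(\mathrm{id}\otimes\pi_n)\circ\Delta_A^\wedge$ maps $\Omega^n(A)$ to $\Omega^0(A)\otimes\Omega^n(H)=A\otimes\Omega^n(H)$. **Proposition.** The vertical forms $\mathfrak{ver}^\bullet(A)$ are a complete differential calculus over $A$: they are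 a differential calculus over $A$, and $\Delta_A$ extends to a morphism of differential graded algebras $\Delta_{\mathfrak{ver}}^\wedge\colon\mathfrak{ver}^\bullet(A)\to\mathfrak{ver}^\bullet(A)\otimes\Omega^\bullet(H)$. Moreover, for every complete differential calculus $\Omega^\bullet(A)$ over $A$, with extension $\Delta_A^\wedge$ of $\Delta_A$, this morphism satisfies $$\Delta_{\mathfrak{ver}}^\wedge\circ\pi_{\mathfrak{ver}}=(\pi_{\mathfrak{ver}}\otimes\mathrm{id})\circ\Delta_A^\wedge .$$ -/

import Mathlib

open scoped TensorProduct DirectSum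

namespace NCG

/-- Criterion for a family of subspaces to be a grading, in terms of projections. -/
theorem isInternal_of_proj {k M : Type*} [Field k] [AddCommGroup M] [Module k M]
    (gr : ℕ → Submodule k M) (p : ℕ → M →ₗ[k] M)
    (hp : ∀ n x, x ∈ gr n → p n x = x)
    (hp' : ∀ n m x, x ∈ gr m → m ≠ n → p n x = 0)
    (htop : ∀ x, x ∈ ⨆ n, gr n) : DirectSum.IsInternal gr := by
  rw [DirectSum.isInternal_submodule_iff_iSupIndep_and_iSup_eq_top]
  refine ⟨fun n => ?_, eq_top_iff.2 fun x _ => htop x⟩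
  rw [Submodule.disjoint_def]
  intro x hx hx'
  have : (⨆ j, ⨆ (_ : j ≠ n), gr j) ≤ LinearMap.ker (p n) :=
    iSup₂_le fun j hj y hy => hp' n j y hy hj
  rw [← hp n x hx]
  exact this hx'

/-- A differential graded algebra over `k` with underlying algebra `Ω`. -/
structure DGA (k : Type*) [Field k] (Ω : Type*) [Ring Ω] [Algebra k Ω] where
  /-- the subspace of forms of degree `n` -/
  gr : ℕ → Submodule k Ω
  gradedMonoid : SetLike.GradedMonoid gr
  isInternal : DirectSum.IsInternal gr
  /-- the differential -/
  d : Ω →ₗ[k] Ω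
  d_mem : ∀ {n : ℕ} {x : Ω}, x ∈ gr n → d x ∈ gr (n + 1)
  d_d : ∀ x : Ω, d (d x) = 0
  leibniz : ∀ {n : ℕ} {x : Ω}, x ∈ gr n → ∀ y : Ω,
    d (x * y) = d x * y + (-1 : k) ^ n • (x * d y)

namespace DGA

variable {k Ω Ω' : Type*} [Field k] [Ring Ω] [Algebra k Ω] [Ring Ω'] [Algebra k Ω']

noncomputable instance gradedAlgebra (D : DGA k Ω) : GradedAlgebra D.gr :=
  { D.gradedMonoid, D.isInternal.chooseDecomposition with }

/-- The projection onto the forms of degree `n`. -/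
noncomputable def proj (D : DGA k Ω) (n : ℕ) : Ω →ₗ[k] Ω := GradedAlgebra.proj D.gr n

/-- The operator which multiplies forms of degree `n` by `(-1) ^ n`. -/
noncomputable def sgn (D : DGA k Ω) : Ω →ₗ[k] Ω :=
  (DirectSum.toModule k ℕ Ω fun n => (-1 : k) ^ n • (D.gr n).subtype) ∘ₗ
    (DirectSum.decomposeLinearEquiv D.gr).toLinearMap

theorem proj_mem (D : DGA k Ω) (n : ℕ) (x : Ω) : D.proj n x ∈ D.gr n := by
  simp [proj, GradedAlgebra.proj_apply]

theorem proj_of_mem (D : DGA k Ω) {n : ℕ} {x : Ω} (hx : x ∈ D.gr n) : D.proj n x = x := by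
  simp [proj, GradedAlgebra.proj_apply, DirectSum.decompose_of_mem_same _ hx]

theorem proj_of_mem_ne (D : DGA k Ω) {n m : ℕ} {x : Ω} (hx : x ∈ D.gr m) (h : m ≠ n) :
    D.proj n x = 0 := by
  simp [proj, GradedAlgebra.proj_apply, DirectSum.decompose_of_mem_ne _ hx h]

theorem sgn_of_mem (D : DGA k Ω) {n : ℕ} {x : Ω} (hx : x ∈ D.gr n) :
    D.sgn x = (-1 : k) ^ n • x := by
  lift x to D.gr n using hx
  simp [sgn]

theorem mem_iSup (D : DGA k Ω) (x : Ω) : x ∈ ⨆ n, D.gr n := by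
  rw [D.isInternal.submodule_iSup_eq_top]; trivial

theorem induction (D : DGA k Ω) {p : Ω → Prop} (x : Ω)
    (h : ∀ n x, x ∈ D.gr n → p x) (h0 : p 0) (hadd : ∀ x y, p x → p y → p (x + y)) : p x :=
  Submodule.iSup_induction D.gr (motive := p) (D.mem_iSup x) h h0 hadd

/-- The graded tensor product `Ω ⊗ Ω'`, as an algebra:
`(a ⊗ b)(a' ⊗ b') = (-1)^{|b||a'|} aa' ⊗ bb'`. -/
abbrev Tensor (D : DGA k Ω) (E : DGA k Ω') : Type _ := D.gr ᵍ⊗[k] E.gr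

section tensor
variable (D : DGA k Ω) (E : DGA k Ω')

/-- The subspace of degree `n` of `Ω ⊗ Ω'`, spanned by all `a ⊗ b` with `|a| + |b| = n`. -/
noncomputable def tensorGr (n : ℕ) : Submodule k (Tensor D E) :=
  Submodule.span k {x | ∃ i j a b, i + j = n ∧ a ∈ D.gr i ∧ b ∈ E.gr j ∧ x = a ᵍ⊗ₜ[k] b}

/-- The differential `d ⊗ id + (-1)^{deg} ⊗ d` of `Ω ⊗ Ω'`. -/
noncomputable def tensorD : Tensor D E →ₗ[k] Tensor D E :=
  (GradedTensorProduct.of k D.gr E.gr).toLinearMap ∘ₗ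
    (TensorProduct.map D.d LinearMap.id + TensorProduct.map D.sgn E.d) ∘ₗ
      (GradedTensorProduct.of k D.gr E.gr).symm.toLinearMap

theorem tensorD_tmul {i : ℕ} {a : Ω} (ha : a ∈ D.gr i) (b : Ω') :
    tensorD D E (a ᵍ⊗ₜ[k] b) = D.d a ᵍ⊗ₜ[k] b + (-1 : k) ^ i • (a ᵍ⊗ₜ[k] E.d b) := by
  simp [tensorD, D.sgn_of_mem ha, ← TensorProduct.smul_tmul']

theorem tmul_mul_tmul {i j : ℕ} (a : Ω) {b : Ω'} (hb : b ∈ E.gr j) {a' : Ω} (ha' : a' ∈ D.gr i)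
    (b' : Ω') : (a ᵍ⊗ₜ[k] b * a' ᵍ⊗ₜ[k] b' : Tensor D E) =
      (-1 : k) ^ (j * i) • ((a * a') ᵍ⊗ₜ[k] (b * b')) := by
  have := GradedTensorProduct.tmul_coe_mul_coe_tmul D.gr E.gr a ⟨b, hb⟩ ⟨a', ha'⟩ b'
  rw [this, Units.smul_def, ← Int.cast_smul_eq_zsmul k]
  simp

theorem tmul_mem {i j : ℕ} {a : Ω} {b : Ω'} (ha : a ∈ D.gr i) (hb : b ∈ E.gr j) :
    (a ᵍ⊗ₜ[k] b : Tensor D E) ∈ tensorGr D E (i + j) :=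
  Submodule.subset_span ⟨i, j, a, b, rfl, ha, hb, rfl⟩

theorem tensor_mem_iSup (x : Tensor D E) : x ∈ ⨆ n, tensorGr D E n := by
  obtain ⟨y, rfl⟩ := (GradedTensorProduct.of k D.gr E.gr).surjective x
  induction y with
  | zero => simp
  | add x y hx hy => rw [map_add]; exact add_mem hx hy
  | tmul a b =>
    induction a using D.induction with
    | h0 => simp
    | hadd x y hx hy => rw [TensorProduct.add_tmul, map_add]; exact add_mem hx hy
    | h i a ha =>
      induction b using E.induction with
      | h0 => simp
      | hadd x y hx hy => rw [TensorProduct.tmul_add, map_add]; exact add_mem hx hy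
      | h j b hb => exact Submodule.mem_iSup_of_mem (i + j) (tmul_mem D E ha hb)

/-- The graded tensor product of two differential graded algebras. -/
noncomputable def tensor : DGA k (Tensor D E) where
  gr := tensorGr D E
  gradedMonoid :=
    { one_mem := by
        have := tmul_mem D E (SetLike.GradedOne.one_mem (A := D.gr))
          (SetLike.GradedOne.one_mem (A := E.gr))
        exact this
      mul_mem := by
        intro m n x y hx hy
        induction hx using Submodule.span_induction with
        | zero => simp
        | add x x' _ _ hx hx' => rw [add_mul]; exact add_mem hx hx'
        | smul c x _ hx => rw [smul_mul_assoc]; exact Submodule.smul_mem _ _ hx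
        | mem x hx =>
          obtain ⟨i, j, a, b, rfl, ha, hb, rfl⟩ := hx
          induction hy using Submodule.span_induction with
          | zero => simp
          | add x x' _ _ hx hx' => rw [mul_add]; exact add_mem hx hx'
          | smul c x _ hx => rw [mul_smul_comm]; exact Submodule.smul_mem _ _ hx
          | mem y hy =>
            obtain ⟨i', j', a', b', rfl, ha', hb', rfl⟩ := hy
            rw [tmul_mul_tmul D E a hb ha' b']
            refine Submodule.smul_mem _ _ ?_
            rw [add_add_add_comm]
            exact tmul_mem D E (SetLike.GradedMul.mul_mem ha ha')
              (SetLike.GradedMul.mul_mem hb hb') }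
  isInternal := by
    refine isInternal_of_proj _ (fun n => (GradedTensorProduct.of k D.gr E.gr).toLinearMap ∘ₗ
      (∑ q ∈ Finset.HasAntidiagonal.antidiagonal n, TensorProduct.map (D.proj q.1) (E.proj q.2)) ∘ₗ
      (GradedTensorProduct.of k D.gr E.gr).symm.toLinearMap) ?_ ?_ (tensor_mem_iSup D E)
    · intro n x hx
      induction hx using Submodule.span_induction with
      | zero => simp
      | add x x' _ _ hx hx' => rw [map_add, hx, hx']
      | smul c x _ hx => rw [map_smul, hx]
      | mem x hx =>
        obtain ⟨i, j, a, b, rfl, ha, hb, rfl⟩ := hx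
        simp only [LinearMap.coe_comp, LinearEquiv.coe_coe, Function.comp_apply,
          GradedTensorProduct.of_symm_of, LinearMap.sum_apply, TensorProduct.map_tmul]
        rw [Finset.sum_eq_single (i, j)]
        · simp [D.proj_of_mem ha, E.proj_of_mem hb]
        · rintro ⟨i', j'⟩ h hne
          by_cases hi : i = i'
          · subst hi
            have : j ≠ j' := fun h => hne (by rw [h])
            simp [E.proj_of_mem_ne hb this]
          · simp [D.proj_of_mem_ne ha hi]
        · intro h; simp at h
    · intro n m x hx hne
      induction hx using Submodule.span_induction with
      | zero => simp
      | add x x' _ _ hx hx' => rw [map_add, hx, hx', add_zero]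
      | smul c x _ hx => rw [map_smul, hx, smul_zero]
      | mem x hx =>
        obtain ⟨i, j, a, b, rfl, ha, hb, rfl⟩ := hx
        simp only [LinearMap.coe_comp, LinearEquiv.coe_coe, Function.comp_apply,
          GradedTensorProduct.of_symm_of, LinearMap.sum_apply, TensorProduct.map_tmul]
        rw [Finset.sum_eq_zero, map_zero]
        rintro ⟨i', j'⟩ h
        rw [Finset.HasAntidiagonal.mem_antidiagonal] at h
        by_cases hi : i = i'
        · have : j ≠ j' := by rintro rfl; exact hne (by rw [hi]; exact h)
          simp [E.proj_of_mem_ne hb this]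
        · simp [D.proj_of_mem_ne ha hi]
  d := tensorD D E
  d_mem := by
    intro n x hx
    induction hx using Submodule.span_induction with
    | zero => simp
    | add x x' _ _ hx hx' => rw [map_add]; exact add_mem hx hx'
    | smul c x _ hx => rw [map_smul]; exact Submodule.smul_mem _ _ hx
    | mem x hx =>
      obtain ⟨i, j, a, b, rfl, ha, hb, rfl⟩ := hx
      rw [tensorD_tmul D E ha]
      refine add_mem ?_ (Submodule.smul_mem _ _ ?_)
      · rw [add_right_comm]; exact tmul_mem D E (D.d_mem ha) hb
      · rw [add_assoc]; exact tmul_mem D E ha (E.d_mem hb)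
  d_d := by
    intro x
    obtain ⟨y, rfl⟩ := (GradedTensorProduct.of k D.gr E.gr).surjective x
    induction y with
    | zero => simp
    | add x y hx hy => rw [map_add, map_add, map_add, hx, hy, add_zero]
    | tmul a b =>
      induction a using D.induction with
      | h0 => simp
      | hadd x y hx hy => rw [TensorProduct.add_tmul, map_add, map_add, map_add, hx, hy, add_zero]
      | h i a ha =>
        change tensorD D E (tensorD D E (a ᵍ⊗ₜ[k] b)) = 0
        rw [tensorD_tmul D E ha, map_add, map_smul, tensorD_tmul D E (D.d_mem ha),
          tensorD_tmul D E ha, D.d_d, E.d_d]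
        simp [pow_succ, GradedTensorProduct.tmul]
  leibniz := by
    intro n x hx y
    induction hx using Submodule.span_induction with
    | zero => simp
    | add x x' _ _ hx hx' => simp only [add_mul, map_add, hx, hx', smul_add]; abel
    | smul c x _ hx =>
      simp only [smul_mul_assoc, map_smul, hx, smul_add, smul_comm c]
    | mem x hx =>
      obtain ⟨i, j, a, b, rfl, ha, hb, rfl⟩ := hx
      obtain ⟨y, rfl⟩ := (GradedTensorProduct.of k D.gr E.gr).surjective y
      induction y with
      | zero => simp
      | add x y hx hy => simp only [map_add, mul_add, hx, hy, smul_add]; abel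
      | tmul a' b' =>
        induction a' using D.induction with
        | h0 => simp
        | hadd x y hx hy =>
          simp only [TensorProduct.add_tmul, map_add, mul_add, hx, hy, smul_add]; abel
        | h i' a' ha' =>
          change tensorD D E (a ᵍ⊗ₜ[k] b * a' ᵍ⊗ₜ[k] b') =
            tensorD D E (a ᵍ⊗ₜ[k] b) * a' ᵍ⊗ₜ[k] b' +
              (-1 : k) ^ (i + j) • (a ᵍ⊗ₜ[k] b * tensorD D E (a' ᵍ⊗ₜ[k] b'))
          rw [tmul_mul_tmul D E a hb ha' b', map_smul,
            tensorD_tmul D E (SetLike.GradedMul.mul_mem ha ha'), tensorD_tmul D E ha,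
            tensorD_tmul D E ha', D.leibniz ha, E.leibniz hb, add_mul, mul_add, smul_mul_assoc,
            mul_smul_comm, tmul_mul_tmul D E _ hb ha', tmul_mul_tmul D E _ (E.d_mem hb) ha',
            tmul_mul_tmul D E _ hb (D.d_mem ha'), tmul_mul_tmul D E _ hb ha']
          simp only [GradedTensorProduct.tmul, TensorProduct.add_tmul, TensorProduct.tmul_add,
            TensorProduct.tmul_smul, ← TensorProduct.smul_tmul', map_add, map_smul, smul_add,
            smul_smul, ← pow_add]
          have h2 : (-1 : k) ^ j * (-1 : k) ^ j = 1 := by rw [← mul_pow]; simp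
          have h3 : (-1 : k) ^ (j * (i' + 1)) = (-1) ^ (j * i') * (-1) ^ j := by
            rw [mul_add, pow_add, mul_one]
          have h4 : (-1 : k) ^ ((j + 1) * i') = (-1) ^ (j * i') * (-1) ^ i' := by
            rw [add_mul, pow_add, one_mul]
          simp only [pow_add, h3, h4]
          generalize (-1 : k) ^ (j * i') = u
          generalize (-1 : k) ^ j = v at h2
          generalize (-1 : k) ^ i = w
          generalize (-1 : k) ^ i' = z
          match_scalars
          · ring
          · linear_combination (-u * w) * h2
          · ring
          · ring

end tensor

/-- A morphism of differential graded algebras. -/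
structure Hom (D : DGA k Ω) (E : DGA k Ω') where
  toAlgHom : Ω →ₐ[k] Ω'
  map_mem : ∀ {n : ℕ} {x : Ω}, x ∈ D.gr n → toAlgHom x ∈ E.gr n
  map_d : ∀ x : Ω, toAlgHom (D.d x) = E.d (toAlgHom x)

end DGA
end NCG

namespace NCG

/-- A first order differential calculus `(Γ, d)` over the algebra `A`. -/
structure FODC (k A Γ : Type*) [Field k] [Ring A] [Algebra k A] [AddCommGroup Γ] [Module k Γ]
    [Module A Γ] [Module Aᵐᵒᵖ Γ] [SMulCommClass A Aᵐᵒᵖ Γ] [IsScalarTower k A Γ]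
    [IsScalarTower k Aᵐᵒᵖ Γ] where
  d : A →ₗ[k] Γ
  leibniz : ∀ a b : A, d (a * b) = MulOpposite.op b • d a + a • d b
  surj : Submodule.span k {ω : Γ | ∃ a b : A, ω = a • d b} = ⊤

section prolongation

variable {k A Γ : Type*} [Field k] [Ring A] [Algebra k A] [AddCommGroup Γ] [Module k Γ]
    [Module A Γ] [Module Aᵐᵒᵖ Γ] [SMulCommClass A Aᵐᵒᵖ Γ] [IsScalarTower k A Γ]
    [IsScalarTower k Aᵐᵒᵖ Γ]

namespace FODC

theorem d_one (C : FODC k A Γ) : C.d 1 = 0 := by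
  have := C.leibniz 1 1
  simpa using this

/-- The relations defining the maximal prolongation: `alg_one`, `alg_mul`, `smul_left` and
`smul_right` present the tensor algebra `A ⊕ Γ ⊕ (Γ ⊗_A Γ) ⊕ ⋯` of the bimodule `Γ` as an algebra
generated by the vector space `A × Γ`, and `wedge` generates the ideal `S^∧`. -/
inductive Rel (C : FODC k A Γ) : TensorAlgebra k (A × Γ) → TensorAlgebra k (A × Γ) → Prop
  | alg_one : Rel C (TensorAlgebra.ι k (1, 0)) 1
  | alg_mul (a b : A) : Rel C (TensorAlgebra.ι k (a * b, 0))
      (TensorAlgebra.ι k (a, 0) * TensorAlgebra.ι k (b, 0))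
  | smul_left (a : A) (ω : Γ) : Rel C (TensorAlgebra.ι k (0, a • ω))
      (TensorAlgebra.ι k (a, 0) * TensorAlgebra.ι k (0, ω))
  | smul_right (a : A) (ω : Γ) : Rel C (TensorAlgebra.ι k (0, MulOpposite.op a • ω))
      (TensorAlgebra.ι k (0, ω) * TensorAlgebra.ι k (a, 0))
  | wedge (n : ℕ) (a b : Fin n → A) (h : ∑ i, a i • C.d (b i) = 0) :
      Rel C (∑ i, TensorAlgebra.ι k (0, C.d (a i)) * TensorAlgebra.ι k (0, C.d (b i))) 0

/-- The maximal prolongation `Γ^∧` of `(Γ, d)`: the quotient of the tensor algebra over `A` of the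
bimodule `Γ` by the ideal generated by all `∑ᵢ d aᵢ ⊗ d bᵢ` with `∑ᵢ aᵢ d bᵢ = 0`. -/
def MaxProl (C : FODC k A Γ) : Type _ := RingQuot C.Rel

variable (C : FODC k A Γ)

noncomputable instance : Ring C.MaxProl := inferInstanceAs (Ring (RingQuot C.Rel))
noncomputable instance : Algebra k C.MaxProl := inferInstanceAs (Algebra k (RingQuot C.Rel))

/-- The canonical map from the tensor algebra of `A × Γ`. -/
noncomputable def toMax : TensorAlgebra k (A × Γ) →ₐ[k] C.MaxProl := RingQuot.mkAlgHom k C.Rel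

theorem toMax_rel {x y : TensorAlgebra k (A × Γ)} (h : C.Rel x y) : C.toMax x = C.toMax y :=
  RingQuot.mkAlgHom_rel k h

/-- The inclusion of `A` as the forms of degree zero. -/
noncomputable def ofAlg : A →ₐ[k] C.MaxProl :=
  AlgHom.ofLinearMap (C.toMax.toLinearMap ∘ₗ TensorAlgebra.ι k ∘ₗ LinearMap.inl k A Γ)
    ((C.toMax_rel .alg_one).trans (map_one _))
    fun a b => (C.toMax_rel (.alg_mul a b)).trans (map_mul _ _ _)

/-- The inclusion of `Γ` as the forms of degree one. -/
noncomputable def ofForm : Γ →ₗ[k] C.MaxProl :=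
  C.toMax.toLinearMap ∘ₗ TensorAlgebra.ι k ∘ₗ LinearMap.inr k A Γ

theorem ofForm_smul (a : A) (ω : Γ) : C.ofForm (a • ω) = C.ofAlg a * C.ofForm ω :=
  (C.toMax_rel (.smul_left a ω)).trans (map_mul _ _ _)

theorem ofForm_op_smul (a : A) (ω : Γ) :
    C.ofForm (MulOpposite.op a • ω) = C.ofForm ω * C.ofAlg a :=
  (C.toMax_rel (.smul_right a ω)).trans (map_mul _ _ _)

theorem ofForm_wedge (n : ℕ) (a b : Fin n → A) (h : ∑ i, a i • C.d (b i) = 0) :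
    ∑ i, C.ofForm (C.d (a i)) * C.ofForm (C.d (b i)) = 0 := by
  have := C.toMax_rel (.wedge n a b h)
  simp only [map_sum, map_mul, map_zero] at this
  exact this

variable {C} in
theorem induction {p : C.MaxProl → Prop} (x : C.MaxProl) (hA : ∀ a, p (C.ofAlg a))
    (hΓ : ∀ ω, p (C.ofForm ω)) (hadd : ∀ x y, p x → p y → p (x + y))
    (hmul : ∀ x y, p x → p y → p (x * y)) : p x := by
  obtain ⟨y, rfl⟩ := RingQuot.mkAlgHom_surjective k C.Rel x
  change p (C.toMax y)
  induction y using TensorAlgebra.induction with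
  | algebraMap r =>
    have := hA (algebraMap k A r)
    rwa [AlgHom.commutes, ← C.toMax.commutes] at this
  | ι x =>
    have : x = (x.1, 0) + (0, x.2) := by simp
    rw [this, map_add, map_add]
    exact hadd _ _ (hA x.1) (hΓ x.2)
  | mul x y hx hy => rw [map_mul]; exact hmul _ _ hx hy
  | add x y hx hy => rw [map_add]; exact hadd _ _ hx hy

section lift
variable {B : Type*} [Ring B] [Algebra k B] (φ : A →ₐ[k] B) (ψ : Γ →ₗ[k] B)
  (hl : ∀ a ω, ψ (a • ω) = φ a * ψ ω) (hr : ∀ a ω, ψ (MulOpposite.op a • ω) = ψ ω * φ a)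
  (hw : ∀ (n : ℕ) (a b : Fin n → A), ∑ i, a i • C.d (b i) = 0 →
    ∑ i, ψ (C.d (a i)) * ψ (C.d (b i)) = 0)

/-- The universal property of the maximal prolongation, as an algebra. -/
noncomputable def lift : C.MaxProl →ₐ[k] B :=
  RingQuot.liftAlgHom k ⟨TensorAlgebra.lift k (φ.toLinearMap.coprod ψ), by
    intro x y h
    induction h with
    | alg_one => simp
    | alg_mul a b => simp
    | smul_left a ω => simp [hl]
    | smul_right a ω => simp [hr]
    | wedge n a b h => simpa using hw n a b h⟩

@[simp]
theorem lift_ofAlg (a : A) : C.lift φ ψ hl hr hw (C.ofAlg a) = φ a := by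
  exact (RingQuot.liftAlgHom_mkAlgHom_apply k (TensorAlgebra.lift k (φ.toLinearMap.coprod ψ)) _
    (TensorAlgebra.ι k (a, 0))).trans (by simp)

@[simp]
theorem lift_ofForm (ω : Γ) : C.lift φ ψ hl hr hw (C.ofForm ω) = ψ ω := by
  exact (RingQuot.liftAlgHom_mkAlgHom_apply k (TensorAlgebra.lift k (φ.toLinearMap.coprod ψ)) _
    (TensorAlgebra.ι k (0, ω))).trans (by simp)

end lift

/-- `a ⊗ b ↦ a d b` -/
noncomputable def adb : A ⊗[k] A →ₗ[k] Γ :=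
  TensorProduct.lift ((Algebra.lsmul k k Γ : A →ₐ[k] Module.End k Γ).toLinearMap.compl₂ C.d)

@[simp] theorem adb_tmul (a b : A) : C.adb (a ⊗ₜ b) = a • C.d b := by simp [adb]

theorem adb_surjective : Function.Surjective C.adb := by
  rw [← LinearMap.range_eq_top, eq_top_iff, ← C.surj, Submodule.span_le]
  rintro _ ⟨a, b, rfl⟩
  exact ⟨a ⊗ₜ b, by simp⟩

theorem exists_adb (ω : Γ) :
    ∃ (n : ℕ) (a b : Fin n → A), ω = ∑ i, a i • C.d (b i) := by
  obtain ⟨t, rfl⟩ := C.adb_surjective ω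
  obtain ⟨S, rfl⟩ := TensorProduct.exists_finset t
  refine ⟨S.card, fun i => (S.equivFin.symm i).1.1, fun i => (S.equivFin.symm i).1.2, ?_⟩
  rw [Equiv.sum_comp S.equivFin.symm (fun i : S => i.1.1 • C.d i.1.2), map_sum,
    Finset.sum_coe_sort S (fun i => i.1 • C.d i.2)]
  simp

/-- `a ⊗ b ↦ d a ∧ d b` -/
noncomputable def dadb : A ⊗[k] A →ₗ[k] C.MaxProl :=
  LinearMap.mul' k C.MaxProl ∘ₗ TensorProduct.map (C.ofForm ∘ₗ C.d) (C.ofForm ∘ₗ C.d)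

theorem ker_adb_le : LinearMap.ker C.adb ≤ LinearMap.ker C.dadb := by
  intro t ht
  obtain ⟨S, rfl⟩ := TensorProduct.exists_finset t
  have h := C.ofForm_wedge S.card (fun i => (S.equivFin.symm i).1.1)
    (fun i => (S.equivFin.symm i).1.2)
  rw [Equiv.sum_comp S.equivFin.symm (fun i : S => i.1.1 • C.d i.1.2),
    Finset.sum_coe_sort S (fun i => i.1 • C.d i.2),
    Equiv.sum_comp S.equivFin.symm (fun i : S => C.ofForm (C.d i.1.1) * C.ofForm (C.d i.1.2)),
    Finset.sum_coe_sort S (fun i => C.ofForm (C.d i.1) * C.ofForm (C.d i.2))] at h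
  simp only [LinearMap.mem_ker, map_sum, adb_tmul] at ht ⊢
  simpa [dadb] using h ht

/-- The differential on `Γ`: `d (∑ᵢ aᵢ d bᵢ) = ∑ᵢ d aᵢ ∧ d bᵢ`. -/
noncomputable def dForm : Γ →ₗ[k] C.MaxProl :=
  (LinearMap.ker C.adb).liftQ C.dadb C.ker_adb_le ∘ₗ
    (C.adb.quotKerEquivOfSurjective C.adb_surjective).symm.toLinearMap

theorem dForm_adb (t : A ⊗[k] A) : C.dForm (C.adb t) = C.dadb t := by
  have : (C.adb.quotKerEquivOfSurjective C.adb_surjective).symm (C.adb t) =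
      Submodule.Quotient.mk t := by
    rw [LinearEquiv.symm_apply_eq]; rfl
  simp [dForm, this]

theorem dForm_smul_d (a b : A) :
    C.dForm (a • C.d b) = C.ofForm (C.d a) * C.ofForm (C.d b) := by
  rw [← adb_tmul, dForm_adb]; simp [dadb]

theorem dForm_d (a : A) : C.dForm (C.d a) = 0 := by
  have := C.dForm_smul_d 1 a
  simpa [d_one] using this

theorem form_induction {p : Γ → Prop} (ω : Γ) (h : ∀ a b : A, p (a • C.d b)) (h0 : p 0)
    (hadd : ∀ x y, p x → p y → p (x + y)) : p ω := by
  obtain ⟨t, rfl⟩ := C.adb_surjective ω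
  induction t with
  | zero => simpa using h0
  | add x y hx hy => rw [map_add]; exact hadd _ _ hx hy
  | tmul a b => simpa using h a b

theorem dForm_smul (a : A) (ω : Γ) :
    C.dForm (a • ω) = C.ofForm (C.d a) * C.ofForm ω + C.ofAlg a * C.dForm ω := by
  induction ω using C.form_induction with
  | h0 => simp
  | hadd x y hx hy => simp only [smul_add, map_add, hx, hy, mul_add]; abel
  | h b c =>
    rw [smul_smul, dForm_smul_d, dForm_smul_d, C.leibniz, map_add, ofForm_op_smul, ofForm_smul,
      ofForm_smul]
    noncomm_ring

theorem dForm_op_smul (a : A) (ω : Γ) :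
    C.dForm (MulOpposite.op a • ω) = C.dForm ω * C.ofAlg a - C.ofForm ω * C.ofForm (C.d a) := by
  induction ω using C.form_induction with
  | h0 => simp
  | hadd x y hx hy => simp only [smul_add, map_add, hx, hy, add_mul]; abel
  | h b c =>
    have e : MulOpposite.op a • b • C.d c = b • C.d (c * a) - (b * c) • C.d a := by
      rw [C.leibniz, smul_add, smul_smul, smul_comm b (MulOpposite.op a)]; abel
    rw [e, map_sub, dForm_smul_d, dForm_smul_d, dForm_smul_d, C.leibniz, C.leibniz, map_add,
      map_add, ofForm_op_smul, ofForm_op_smul, ofForm_smul, ofForm_smul]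
    noncomm_ring

/-- The algebra automorphism which is `(-1) ^ n` on forms of degree `n`. -/
noncomputable def parity : C.MaxProl →ₐ[k] C.MaxProl :=
  C.lift C.ofAlg (-C.ofForm) (by simp [ofForm_smul]) (by simp [ofForm_op_smul]) (by
    intro n a b h
    simpa using C.ofForm_wedge n a b h)

/-- Auxiliary: `a ↦ [[a, d a], [0, a]]`. -/
noncomputable def dAuxAlg : A →ₐ[k] Matrix (Fin 2) (Fin 2) C.MaxProl :=
  AlgHom.ofLinearMap
    { toFun := fun a => !![C.ofAlg a, C.ofForm (C.d a); 0, C.ofAlg a]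
      map_add' := by intro a b; simp
      map_smul' := by intro a b; simp [Matrix.smul_of] }
    (by simp [d_one, Matrix.one_fin_two])
    (by
      intro a b
      simp [C.leibniz, ofForm_op_smul, ofForm_smul, add_comm])

/-- Auxiliary: `ω ↦ [[-ω, d ω], [0, ω]]`. -/
noncomputable def dAuxForm : Γ →ₗ[k] Matrix (Fin 2) (Fin 2) C.MaxProl where
  toFun := fun ω => !![-C.ofForm ω, C.dForm ω; 0, C.ofForm ω]
  map_add' := by intro a b; simp [add_comm]
  map_smul' := by intro a b; simp [Matrix.smul_of]

/-- Auxiliary: `x ↦ [[(-1)^{|x|} x, d x], [0, x]]`. -/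
noncomputable def dAux : C.MaxProl →ₐ[k] Matrix (Fin 2) (Fin 2) C.MaxProl :=
  C.lift C.dAuxAlg C.dAuxForm
    (by
      intro a ω
      simp [dAuxAlg, dAuxForm, ofForm_smul, dForm_smul, add_comm])
    (by
      intro a ω
      simp [dAuxAlg, dAuxForm, ofForm_op_smul, dForm_op_smul]
      abel)
    (by
      intro n a b h
      have := C.ofForm_wedge n a b h
      have e : ∀ i, C.dAuxForm (C.d (a i)) * C.dAuxForm (C.d (b i)) =
          Matrix.diagonal fun _ => C.ofForm (C.d (a i)) * C.ofForm (C.d (b i)) := by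
        intro i
        ext i j
        fin_cases i <;> fin_cases j <;> simp [dAuxForm, dForm_d]
      rw [Finset.sum_congr rfl fun i _ => e i]
      ext i j
      rw [Matrix.sum_apply]
      by_cases hij : i = j
      · subst hij; simpa using this
      · simp [hij])

/-- The differential of the maximal prolongation. -/
noncomputable def dMax : C.MaxProl →ₗ[k] C.MaxProl where
  toFun x := C.dAux x 0 1
  map_add' x y := by simp
  map_smul' c x := by simp

@[simp] theorem parity_ofAlg (a : A) : C.parity (C.ofAlg a) = C.ofAlg a := by simp [parity]
@[simp] theorem parity_ofForm (ω : Γ) : C.parity (C.ofForm ω) = -C.ofForm ω := by simp [parity]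
@[simp] theorem dMax_ofAlg (a : A) : C.dMax (C.ofAlg a) = C.ofForm (C.d a) := by
  simp [dMax, dAux, dAuxAlg, dAuxForm]
@[simp] theorem dMax_ofForm (ω : Γ) : C.dMax (C.ofForm ω) = C.dForm ω := by
  simp [dMax, dAux, dAuxAlg, dAuxForm]

theorem dAux_eq (x : C.MaxProl) : C.dAux x = !![C.parity x, C.dMax x; 0, x] := by
  induction x using induction with
  | hA a => simp [dAux, dAuxAlg, dAuxForm]
  | hΓ ω => simp [dAux, dAuxAlg, dAuxForm]
  | hadd x y hx hy =>
    rw [map_add, hx, hy]; simp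
  | hmul x y hx hy =>
    have h : C.dMax (x * y) = C.parity x * C.dMax y + C.dMax x * y := by
      change C.dAux (x * y) 0 1 = _
      rw [map_mul, hx, hy]; simp
    rw [map_mul, hx, hy, h]; simp

theorem dMax_mul (x y : C.MaxProl) :
    C.dMax (x * y) = C.dMax x * y + C.parity x * C.dMax y := by
  change C.dAux (x * y) 0 1 = _
  rw [map_mul, dAux_eq, dAux_eq]; simp [add_comm]

theorem dMax_parity (x : C.MaxProl) : C.dMax (C.parity x) = -C.parity (C.dMax x) := by
  induction x using induction with
  | hA a => simp
  | hΓ ω =>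
    induction ω using C.form_induction with
    | h0 => simp
    | hadd x y hx hy => simp only [map_add, hx, hy]; abel
    | h a b => simp [dForm_smul_d]
  | hadd x y hx hy => simp only [map_add, hx, hy]; abel
  | hmul x y hx hy => simp only [map_mul, map_add, dMax_mul, hx, hy]; noncomm_ring

theorem dMax_dMax (x : C.MaxProl) : C.dMax (C.dMax x) = 0 := by
  induction x using induction with
  | hA a => simp [dForm_d]
  | hΓ ω =>
    induction ω using C.form_induction with
    | h0 => simp
    | hadd x y hx hy => simp only [map_add, hx, hy, add_zero]
    | h a b => simp [dForm_smul_d, dMax_mul, dForm_d]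
  | hadd x y hx hy => simp only [map_add, hx, hy, add_zero]
  | hmul x y hx hy => simp [map_add, dMax_mul, hx, hy, dMax_parity]

/-- The forms of degree `n`: the image of `Γ ⊗_A ⋯ ⊗_A Γ` (`n` factors). -/
noncomputable def grMax (n : ℕ) : Submodule k C.MaxProl :=
  LinearMap.range C.ofAlg.toLinearMap * LinearMap.range C.ofForm ^ n

theorem grMax_zero : C.grMax 0 = LinearMap.range C.ofAlg.toLinearMap := by
  simp [grMax]

theorem grMax_succ (n : ℕ) : C.grMax (n + 1) = C.grMax n * LinearMap.range C.ofForm := by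
  simp [grMax, pow_succ, mul_assoc]

theorem ofAlg_mem (a : A) : C.ofAlg a ∈ C.grMax 0 := by
  rw [grMax_zero]; exact ⟨a, rfl⟩

theorem range_mul_range : LinearMap.range C.ofAlg.toLinearMap * LinearMap.range C.ofForm =
    LinearMap.range C.ofForm := by
  apply le_antisymm
  · rw [Submodule.mul_le]
    rintro _ ⟨a, rfl⟩ _ ⟨ω, rfl⟩
    exact ⟨a • ω, by simp [ofForm_smul]⟩
  · rintro _ ⟨ω, rfl⟩
    rw [← one_mul (C.ofForm ω), ← map_one C.ofAlg]
    exact Submodule.mul_mem_mul ⟨1, rfl⟩ ⟨ω, rfl⟩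

theorem range_mul_range' : LinearMap.range C.ofForm * LinearMap.range C.ofAlg.toLinearMap =
    LinearMap.range C.ofForm := by
  apply le_antisymm
  · rw [Submodule.mul_le]
    rintro _ ⟨ω, rfl⟩ _ ⟨a, rfl⟩
    exact ⟨MulOpposite.op a • ω, by simp [ofForm_op_smul]⟩
  · rintro _ ⟨ω, rfl⟩
    rw [← mul_one (C.ofForm ω), ← map_one C.ofAlg]
    exact Submodule.mul_mem_mul ⟨ω, rfl⟩ ⟨1, rfl⟩

theorem grMax_one : C.grMax 1 = LinearMap.range C.ofForm := by
  rw [grMax, pow_one, range_mul_range]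

theorem ofForm_mem (ω : Γ) : C.ofForm ω ∈ C.grMax 1 := by
  rw [grMax_one]; exact ⟨ω, rfl⟩

theorem grMax_mul (m n : ℕ) : C.grMax m * C.grMax n = C.grMax (m + n) := by
  have hc : Commute (LinearMap.range C.ofForm) (LinearMap.range C.ofAlg.toLinearMap) := by
    rw [Commute, SemiconjBy, range_mul_range, range_mul_range']
  have h0 : LinearMap.range C.ofAlg.toLinearMap * LinearMap.range C.ofAlg.toLinearMap =
      LinearMap.range C.ofAlg.toLinearMap := by
    have : LinearMap.range C.ofAlg.toLinearMap = Subalgebra.toSubmodule C.ofAlg.range := rfl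
    rw [this, Subalgebra.isIdempotentElem_toSubmodule]
  rw [grMax, grMax, grMax, mul_assoc, ← mul_assoc (_ ^ m), (hc.pow_left m).eq, mul_assoc,
    ← mul_assoc, h0, pow_add]

theorem mul_mem_grMax {m n : ℕ} {x y : C.MaxProl} (hx : x ∈ C.grMax m) (hy : y ∈ C.grMax n) :
    x * y ∈ C.grMax (m + n) := by
  rw [← grMax_mul]; exact Submodule.mul_mem_mul hx hy

theorem mem_grMax_induction {p : ∀ n, C.MaxProl → Prop}
    (hA : ∀ a, p 0 (C.ofAlg a))
    (hadd : ∀ n x y, p n x → p n y → p n (x + y))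
    (hmul : ∀ (n : ℕ) (x : C.MaxProl) (ω : Γ), x ∈ C.grMax n → p n x → p (n + 1) (x * C.ofForm ω))
    (n : ℕ) (x : C.MaxProl) (hx : x ∈ C.grMax n) : p n x := by
  induction n generalizing x with
  | zero => rw [grMax_zero] at hx; obtain ⟨a, rfl⟩ := hx; exact hA a
  | succ n ih =>
    rw [grMax_succ] at hx
    induction hx using Submodule.mul_induction_on' with
    | mem_mul_mem x hx y hy => obtain ⟨ω, rfl⟩ := hy; exact hmul n x ω hx (ih x hx)
    | add x _ y _ hx hy => exact hadd _ _ _ hx hy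

theorem parity_of_mem (n : ℕ) (x : C.MaxProl) (hx : x ∈ C.grMax n) :
    C.parity x = (-1 : k) ^ n • x := by
  refine C.mem_grMax_induction (p := fun n x => C.parity x = (-1 : k) ^ n • x) ?_ ?_ ?_ n x hx
  · intro a; rw [parity_ofAlg, pow_zero, one_smul]
  · intro n x y hx hy; rw [map_add, hx, hy, smul_add]
  · intro n x ω _ hx
    rw [map_mul, hx, parity_ofForm, pow_succ, smul_mul_assoc, mul_neg, mul_neg_one, neg_smul,
      smul_neg]

theorem dForm_mem (ω : Γ) : C.dForm ω ∈ C.grMax 2 := by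
  induction ω using C.form_induction with
  | h0 => simp
  | hadd x y hx hy => rw [map_add]; exact add_mem hx hy
  | h a b =>
    rw [dForm_smul_d, ← one_add_one_eq_two]
    exact C.mul_mem_grMax (C.ofForm_mem _) (C.ofForm_mem _)

theorem dMax_mem (n : ℕ) (x : C.MaxProl) (hx : x ∈ C.grMax n) : C.dMax x ∈ C.grMax (n + 1) := by
  refine C.mem_grMax_induction (p := fun n x => C.dMax x ∈ C.grMax (n + 1)) ?_ ?_ ?_ n x hx
  · intro a; rw [dMax_ofAlg]; exact C.ofForm_mem _
  · intro n x y hx hy; rw [map_add]; exact add_mem hx hy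
  · intro n x ω h hx
    rw [dMax_mul, dMax_ofForm, C.parity_of_mem n x h]
    have h1 : C.dMax x * C.ofForm ω ∈ C.grMax (n + 1 + 1) := C.mul_mem_grMax hx (C.ofForm_mem ω)
    have h2 : ((-1 : k) ^ n • x) * C.dForm ω ∈ C.grMax (n + 2) :=
      C.mul_mem_grMax (Submodule.smul_mem (C.grMax n) _ h) (C.dForm_mem ω)
    exact add_mem h1 h2

/-- Auxiliary: `x ↦ x X^{|x|}`, which separates the degrees. -/
noncomputable def degAux : C.MaxProl →ₐ[k] Polynomial C.MaxProl :=
  C.lift (Polynomial.CAlgHom.comp C.ofAlg)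
    (((Polynomial.monomial 1 : C.MaxProl →ₗ[C.MaxProl] _).restrictScalars k) ∘ₗ C.ofForm)
    (by
      intro a ω
      change Polynomial.monomial 1 (C.ofForm (a • ω)) =
        Polynomial.C (C.ofAlg a) * Polynomial.monomial 1 (C.ofForm ω)
      rw [ofForm_smul, Polynomial.C_mul_monomial])
    (by
      intro a ω
      change Polynomial.monomial 1 (C.ofForm (MulOpposite.op a • ω)) =
        Polynomial.monomial 1 (C.ofForm ω) * Polynomial.C (C.ofAlg a)
      rw [ofForm_op_smul, Polynomial.monomial_mul_C])
    (by
      intro n a b h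
      have := C.ofForm_wedge n a b h
      simp only [LinearMap.comp_apply, LinearMap.restrictScalars_apply,
        Polynomial.monomial_mul_monomial, ← map_sum, this, map_zero])

theorem degAux_of_mem (n : ℕ) (x : C.MaxProl) (hx : x ∈ C.grMax n) :
    C.degAux x = Polynomial.monomial n x := by
  refine C.mem_grMax_induction (p := fun n x => C.degAux x = Polynomial.monomial n x)
    ?_ ?_ ?_ n x hx
  · intro a; simp [degAux]
  · intro n x y hx hy; simp [hx, hy]
  · intro n x ω _ hx
    rw [map_mul, hx]; simp [degAux, Polynomial.monomial_mul_monomial]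

/-- The maximal prolongation as a differential graded algebra. -/
noncomputable def dga : DGA k C.MaxProl where
  gr := C.grMax
  gradedMonoid :=
    { one_mem := by rw [← map_one C.ofAlg]; exact C.ofAlg_mem 1
      mul_mem := fun _ _ _ _ => C.mul_mem_grMax }
  isInternal := by
    refine isInternal_of_proj _
      (fun n => ((Polynomial.lcoeff C.MaxProl n).restrictScalars k) ∘ₗ C.degAux.toLinearMap)
      ?_ ?_ ?_
    · intro n x hx
      simp [C.degAux_of_mem n x hx]
    · intro n m x hx h
      simp [C.degAux_of_mem m x hx, Polynomial.coeff_monomial, h]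
    · intro x
      induction x using induction with
      | hA a => exact Submodule.mem_iSup_of_mem 0 (C.ofAlg_mem a)
      | hΓ ω => exact Submodule.mem_iSup_of_mem 1 (C.ofForm_mem ω)
      | hadd x y hx hy => exact add_mem hx hy
      | hmul x y hx hy =>
        induction hx using Submodule.iSup_induction' with
        | zero => simp
        | add x x' _ _ hx hx' => rw [add_mul]; exact add_mem hx hx'
        | mem m x hx =>
          induction hy using Submodule.iSup_induction' with
          | zero => simp
          | add y y' _ _ hy hy' => rw [mul_add]; exact add_mem hy hy'
          | mem n y hy => exact Submodule.mem_iSup_of_mem (m + n) (C.mul_mem_grMax hx hy)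
  d := C.dMax
  d_mem := C.dMax_mem _ _
  d_d := C.dMax_dMax
  leibniz := by
    intro n x hx y
    rw [dMax_mul, C.parity_of_mem n x hx, smul_mul_assoc]

end FODC
end prolongation
end NCG

namespace NCG
namespace FODC

section covariance

variable {k H Γ : Type*} [Field k] [Ring H] [HopfAlgebra k H] [AddCommGroup Γ] [Module k Γ]
    [Module H Γ] [Module Hᵐᵒᵖ Γ] [SMulCommClass H Hᵐᵒᵖ Γ] [IsScalarTower k H Γ]
    [IsScalarTower k Hᵐᵒᵖ Γ]

variable (k H Γ) in
/-- The left action of `H` on `Γ`, `a ↦ ω ↦ a ω`. -/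
noncomputable def lact : H →ₗ[k] Γ →ₗ[k] Γ :=
  (Algebra.lsmul k k Γ : H →ₐ[k] Module.End k Γ).toLinearMap

variable (k H Γ) in
/-- The right action of `H` on `Γ`, `ω ↦ a ↦ ω a`. -/
noncomputable def ract : Γ →ₗ[k] H →ₗ[k] Γ :=
  ((Algebra.lsmul k k Γ : Hᵐᵒᵖ →ₐ[k] Module.End k Γ).toLinearMap ∘ₗ
    (MulOpposite.opLinearEquiv k).toLinearMap).flip

@[simp] theorem lact_apply (a : H) (ω : Γ) : lact k H Γ a ω = a • ω := rfl
@[simp] theorem ract_apply (a : H) (ω : Γ) : ract k H Γ ω a = MulOpposite.op a • ω := rfl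

/-- A left covariant first order calculus: a left coaction of `H` on `Γ`, which is a map of
bimodules over `Δ` and for which `d` is colinear. -/
structure LeftCovariant (C : FODC k H Γ) where
  coact : Γ →ₗ[k] H ⊗[k] Γ
  coassoc : ∀ ω, TensorProduct.assoc k H H Γ
    ((Coalgebra.comul (R := k) (A := H)).rTensor Γ (coact ω)) = coact.lTensor H (coact ω)
  counit : ∀ ω, TensorProduct.lid k Γ
    ((Coalgebra.counit (R := k) (A := H)).rTensor Γ (coact ω)) = ω
  coact_smul : ∀ (a : H) (ω : Γ), coact (a • ω) =
    TensorProduct.map₂ (LinearMap.mul k H) (lact k H Γ) (Coalgebra.comul (R := k) a) (coact ω)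
  coact_op_smul : ∀ (a : H) (ω : Γ), coact (MulOpposite.op a • ω) =
    TensorProduct.map₂ (LinearMap.mul k H) (ract k H Γ) (coact ω) (Coalgebra.comul (R := k) a)
  coact_d : ∀ a : H, coact (C.d a) = C.d.lTensor H (Coalgebra.comul (R := k) a)

/-- A right covariant first order calculus: a right coaction of `H` on `Γ`, which is a map of
bimodules over `Δ` and for which `d` is colinear. -/
structure RightCovariant (C : FODC k H Γ) where
  coact : Γ →ₗ[k] Γ ⊗[k] H
  coassoc : ∀ ω, TensorProduct.assoc k Γ H H (coact.rTensor H (coact ω)) =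
    (Coalgebra.comul (R := k) (A := H)).lTensor Γ (coact ω)
  counit : ∀ ω, TensorProduct.rid k Γ
    ((Coalgebra.counit (R := k) (A := H)).lTensor Γ (coact ω)) = ω
  coact_smul : ∀ (a : H) (ω : Γ), coact (a • ω) =
    TensorProduct.map₂ (lact k H Γ) (LinearMap.mul k H) (Coalgebra.comul (R := k) a) (coact ω)
  coact_op_smul : ∀ (a : H) (ω : Γ), coact (MulOpposite.op a • ω) =
    TensorProduct.map₂ (ract k H Γ) (LinearMap.mul k H) (coact ω) (Coalgebra.comul (R := k) a)
  coact_d : ∀ a : H, coact (C.d a) = C.d.rTensor H (Coalgebra.comul (R := k) a)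

variable {C : FODC k H Γ}

variable (C) in
/-- The coproduct of `H`, as a map to `H ⊗ Γ^∧`. -/
noncomputable def comulMax : H →ₐ[k] H ⊗[k] C.MaxProl :=
  (Algebra.TensorProduct.map (AlgHom.id k H) C.ofAlg).comp (Bialgebra.comulAlgHom k H)

theorem comulMax_apply (a : H) :
    C.comulMax a = C.ofAlg.toLinearMap.lTensor H (Coalgebra.comul (R := k) a) := rfl

theorem lTensor_d_mul (s t : H ⊗[k] H) :
    C.dMax.lTensor H (C.ofAlg.toLinearMap.lTensor H s * (C.ofForm ∘ₗ C.d).lTensor H t) =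
      (C.ofForm ∘ₗ C.d).lTensor H s * (C.ofForm ∘ₗ C.d).lTensor H t := by
  induction s with
  | zero => simp
  | add x y hx hy => simp only [map_add, add_mul, hx, hy]
  | tmul a b =>
    induction t with
    | zero => simp
    | add x y hx hy => simp only [map_add, mul_add, hx, hy]
    | tmul a' b' => simp [dMax_mul, dForm_d]

namespace LeftCovariant

variable (L : C.LeftCovariant)

theorem ofForm_coact_smul (a : H) (ω : Γ) : C.ofForm.lTensor H (L.coact (a • ω)) =
    C.comulMax a * C.ofForm.lTensor H (L.coact ω) := by
  rw [L.coact_smul, comulMax_apply]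
  generalize (Coalgebra.comul (R := k) a) = s
  generalize L.coact ω = t
  induction s with
  | zero => simp
  | add x y hx hy => simp only [map_add, LinearMap.add_apply, add_mul, hx, hy]
  | tmul a b =>
    induction t with
    | zero => simp
    | add x y hx hy => simp only [map_add, mul_add, hx, hy]
    | tmul a' b' => simp [ofForm_smul]

theorem ofForm_coact_op_smul (a : H) (ω : Γ) :
    C.ofForm.lTensor H (L.coact (MulOpposite.op a • ω)) =
      C.ofForm.lTensor H (L.coact ω) * C.comulMax a := by
  rw [L.coact_op_smul, comulMax_apply]
  generalize (Coalgebra.comul (R := k) a) = s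
  generalize L.coact ω = t
  induction s with
  | zero => simp
  | add x y hx hy => simp only [map_add, mul_add, hx, hy]
  | tmul a b =>
    induction t with
    | zero => simp
    | add x y hx hy => simp only [map_add, LinearMap.add_apply, add_mul, hx, hy]
    | tmul a' b' => simp [ofForm_op_smul]

theorem ofForm_coact_d (a : H) : C.ofForm.lTensor H (L.coact (C.d a)) =
    (C.ofForm ∘ₗ C.d).lTensor H (Coalgebra.comul (R := k) a) := by
  rw [L.coact_d, LinearMap.lTensor_comp_apply]

/-- The left coaction on `Γ^∧`: the algebra map extending the coproduct of `H` and the left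
coaction on `Γ`. -/
noncomputable def coactMax : C.MaxProl →ₐ[k] H ⊗[k] C.MaxProl :=
  C.lift C.comulMax (C.ofForm.lTensor H ∘ₗ L.coact) L.ofForm_coact_smul L.ofForm_coact_op_smul (by
    intro n a b h
    simp only [LinearMap.comp_apply, L.ofForm_coact_d]
    rw [← map_zero (C.dMax.lTensor H), ← map_zero (C.ofForm.lTensor H), ← map_zero L.coact, ← h]
    simp only [map_sum, L.ofForm_coact_smul, L.ofForm_coact_d, comulMax_apply, lTensor_d_mul])

@[simp] theorem coactMax_ofAlg (a : H) : L.coactMax (C.ofAlg a) = C.comulMax a := by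
  simp [coactMax]

@[simp] theorem coactMax_ofForm (ω : Γ) :
    L.coactMax (C.ofForm ω) = C.ofForm.lTensor H (L.coact ω) := by simp [coactMax]

theorem coactMax_d (a : H) : L.coactMax (C.ofForm (C.d a)) =
    (C.ofForm ∘ₗ C.d).lTensor H (Coalgebra.comul (R := k) a) := by
  rw [coactMax_ofForm, ofForm_coact_d]

theorem coactMax_parity (x : C.MaxProl) :
    L.coactMax (C.parity x) = C.parity.toLinearMap.lTensor H (L.coactMax x) := by
  change L.coactMax (C.parity x) = Algebra.TensorProduct.map (AlgHom.id k H) C.parity (L.coactMax x)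
  induction x using induction with
  | hA a =>
    rw [parity_ofAlg, coactMax_ofAlg, comulMax_apply]
    generalize (Coalgebra.comul (R := k) a) = s
    induction s with
    | zero => simp
    | add x y hx hy => rw [map_add, map_add, ← hx, ← hy]
    | tmul a b => simp
  | hΓ ω =>
    rw [parity_ofForm, map_neg, coactMax_ofForm]
    generalize L.coact ω = s
    induction s with
    | zero => simp
    | add x y hx hy => rw [map_add, map_add, ← hx, ← hy, neg_add]
    | tmul a b => simp [TensorProduct.tmul_neg]
  | hadd x y hx hy => simp only [map_add, hx, hy]
  | hmul x y hx hy => simp only [map_mul, hx, hy]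

variable (C) in
/-- `id ⊗ d` is a derivation of `H ⊗ Γ^∧`. -/
theorem lTensor_dMax_mul {A : Type*} [Ring A] [Algebra k A] (x y : A ⊗[k] C.MaxProl) :
    C.dMax.lTensor A (x * y) = C.dMax.lTensor A x * y +
      C.parity.toLinearMap.lTensor A x * C.dMax.lTensor A y := by
  induction x with
  | zero => simp
  | add x y hx hy => simp only [map_add, add_mul, hx, hy]; abel
  | tmul a b =>
    induction y with
    | zero => simp
    | add x y hx hy => simp only [map_add, mul_add, hx, hy]; abel
    | tmul a' b' => simp [dMax_mul, TensorProduct.tmul_add]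

theorem coactMax_dMax (x : C.MaxProl) :
    L.coactMax (C.dMax x) = C.dMax.lTensor H (L.coactMax x) := by
  induction x using induction with
  | hA a =>
    rw [dMax_ofAlg, coactMax_d, coactMax_ofAlg, comulMax_apply, ← LinearMap.lTensor_comp_apply]
    congr 1
    congr 1
    ext x
    simp
  | hΓ ω =>
    induction ω using C.form_induction with
    | h0 => simp
    | hadd x y hx hy => simp only [map_add, hx, hy]
    | h a b =>
      rw [dMax_ofForm, dForm_smul_d, map_mul, coactMax_d, coactMax_d, ofForm_smul, map_mul,
        coactMax_ofAlg, coactMax_d, comulMax_apply, lTensor_d_mul]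
  | hadd x y hx hy => simp only [map_add, hx, hy]
  | hmul x y hx hy => rw [dMax_mul, map_add, map_mul, map_mul, hx, hy, coactMax_parity, map_mul,
      lTensor_dMax_mul]

theorem coactMax_coassoc (x : C.MaxProl) :
    TensorProduct.assoc k H H C.MaxProl
      ((Coalgebra.comul (R := k) (A := H)).rTensor C.MaxProl (L.coactMax x)) =
      L.coactMax.toLinearMap.lTensor H (L.coactMax x) := by
  change ((Algebra.TensorProduct.assoc k k k H H C.MaxProl).toAlgHom.comp
    (Algebra.TensorProduct.map (Bialgebra.comulAlgHom k H) (AlgHom.id k C.MaxProl))) (L.coactMax x)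
    = Algebra.TensorProduct.map (AlgHom.id k H) L.coactMax (L.coactMax x)
  induction x using induction with
  | hA a =>
    have e : ∀ s : H ⊗[k] H, ((Algebra.TensorProduct.assoc k k k H H C.MaxProl).toAlgHom.comp
        (Algebra.TensorProduct.map (Bialgebra.comulAlgHom k H) (AlgHom.id k C.MaxProl)))
        (C.ofAlg.toLinearMap.lTensor H s) = (C.ofAlg.toLinearMap.lTensor H).lTensor H
          (TensorProduct.assoc k H H H ((Coalgebra.comul (R := k) (A := H)).rTensor H s)) := by
      intro s
      induction s with
      | zero => simp
      | add x y hx hy => simp only [map_add, hx, hy]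
      | tmul a b =>
        simp only [LinearMap.lTensor_tmul, LinearMap.rTensor_tmul, AlgHom.comp_apply,
          Algebra.TensorProduct.map_tmul, Bialgebra.comulAlgHom_apply]
        generalize (Coalgebra.comul (R := k) a) = t
        induction t with
        | zero => simp
        | add x y hx hy => simp only [map_add, TensorProduct.add_tmul, hx, hy]
        | tmul a b => simp
    rw [coactMax_ofAlg, comulMax_apply, e, Coalgebra.coassoc_apply]
    generalize (Coalgebra.comul (R := k) a) = s
    induction s with
    | zero => simp
    | add x y hx hy => simp only [map_add, hx, hy]
    | tmul a b => simp [comulMax_apply]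
  | hΓ ω =>
    have e : ∀ s : H ⊗[k] Γ, ((Algebra.TensorProduct.assoc k k k H H C.MaxProl).toAlgHom.comp
        (Algebra.TensorProduct.map (Bialgebra.comulAlgHom k H) (AlgHom.id k C.MaxProl)))
        (C.ofForm.lTensor H s) = (C.ofForm.lTensor H).lTensor H
          (TensorProduct.assoc k H H Γ ((Coalgebra.comul (R := k) (A := H)).rTensor Γ s)) := by
      intro s
      induction s with
      | zero => simp
      | add x y hx hy => simp only [map_add, hx, hy]
      | tmul a b =>
        simp only [LinearMap.lTensor_tmul, LinearMap.rTensor_tmul, AlgHom.comp_apply,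
          Algebra.TensorProduct.map_tmul, Bialgebra.comulAlgHom_apply]
        generalize (Coalgebra.comul (R := k) a) = t
        induction t with
        | zero => simp
        | add x y hx hy => simp only [map_add, TensorProduct.add_tmul, hx, hy]
        | tmul a b => simp
    rw [coactMax_ofForm, e, L.coassoc]
    generalize L.coact ω = s
    induction s with
    | zero => simp
    | add x y hx hy => simp only [map_add, hx, hy]
    | tmul a b => simp
  | hadd x y hx hy => simp only [map_add, hx, hy]
  | hmul x y hx hy => simp only [map_mul, hx, hy]

/-- `Λ^•`: the algebra of left invariant forms. -/
noncomputable def inv : Subalgebra k C.MaxProl :=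
  AlgHom.equalizer L.coactMax Algebra.TensorProduct.includeRight

theorem mem_inv {x : C.MaxProl} : x ∈ L.inv ↔ L.coactMax x = 1 ⊗ₜ x := Iff.rfl

/-- The map `ω ↦ S(ω₋₁) ω₀` of `Γ^∧` to itself. -/
noncomputable def piInvAux : C.MaxProl →ₗ[k] C.MaxProl :=
  LinearMap.mul' k C.MaxProl ∘ₗ
    (C.ofAlg.toLinearMap ∘ₗ HopfAlgebra.antipode k (A := H)).rTensor C.MaxProl ∘ₗ
      L.coactMax.toLinearMap

open WithConv in
theorem antipode_comulMax (a : H) :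
    LinearMap.mul' k (H ⊗[k] C.MaxProl) (TensorProduct.map
      (C.comulMax.toLinearMap ∘ₗ HopfAlgebra.antipode k (A := H))
      (Algebra.TensorProduct.includeLeft : H →ₐ[k] H ⊗[k] C.MaxProl).toLinearMap
      (Coalgebra.comul (R := k) a)) = 1 ⊗ₜ C.ofAlg (HopfAlgebra.antipode k a) := by
  let φ := toConv C.comulMax.toLinearMap
  let φS := toConv (C.comulMax.toLinearMap ∘ₗ HopfAlgebra.antipode k (A := H))
  let i := toConv (Algebra.TensorProduct.includeLeft : H →ₐ[k] H ⊗[k] C.MaxProl).toLinearMap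
  let g : H →ₐ[k] H ⊗[k] C.MaxProl := Algebra.TensorProduct.includeRight.comp C.ofAlg
  let j := toConv g.toLinearMap
  let jS := toConv (g.toLinearMap ∘ₗ HopfAlgebra.antipode k (A := H))
  have key : ∀ f : H →ₐ[k] H ⊗[k] C.MaxProl,
      toConv (f.toLinearMap ∘ₗ HopfAlgebra.antipode k (A := H)) * toConv f.toLinearMap = 1 := by
    intro f
    have := LinearMap.algHom_comp_convMul_distrib f (toConv (HopfAlgebra.antipode k (A := H)))
      (toConv LinearMap.id)
    rw [LinearMap.antipode_mul_id] at this
    apply WithConv.ofConv_injective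
    refine this.symm.trans ?_
    ext x
    simp [LinearMap.convOne_def]
  have key' : ∀ f : H →ₐ[k] H ⊗[k] C.MaxProl,
      toConv f.toLinearMap * toConv (f.toLinearMap ∘ₗ HopfAlgebra.antipode k (A := H)) = 1 := by
    intro f
    have := LinearMap.algHom_comp_convMul_distrib f (toConv LinearMap.id)
      (toConv (HopfAlgebra.antipode k (A := H)))
    rw [LinearMap.id_mul_antipode] at this
    apply WithConv.ofConv_injective
    refine this.symm.trans ?_
    ext x
    simp [LinearMap.convOne_def]
  have h1 : φ = i * j := by
    apply WithConv.ofConv_injective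
    ext x
    change C.comulMax x = LinearMap.mul' k _ (TensorProduct.map _ _ (Coalgebra.comul (R := k) x))
    rw [comulMax_apply]
    generalize (Coalgebra.comul (R := k) x) = s
    induction s with
    | zero => simp
    | add x y hx hy => simp only [map_add, hx, hy]
    | tmul a b => simp [i, j, g]
  have h2 : φS * i = jS := by
    calc φS * i = φS * (i * (j * jS)) := by rw [key' g, mul_one]
      _ = (φS * φ) * jS := by rw [h1, mul_assoc, mul_assoc]
      _ = jS := by rw [key C.comulMax, one_mul]
  have := congr(($h2).ofConv a)
  exact this

theorem piInvAux_mem (x : C.MaxProl) : L.piInvAux x ∈ L.inv := by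
  rw [mem_inv]
  have e1 : ∀ t : H ⊗[k] C.MaxProl,
      L.coactMax (LinearMap.mul' k C.MaxProl
        ((C.ofAlg.toLinearMap ∘ₗ HopfAlgebra.antipode k (A := H)).rTensor C.MaxProl t)) =
      LinearMap.mul' k _ (TensorProduct.map
        (C.comulMax.toLinearMap ∘ₗ HopfAlgebra.antipode k (A := H)) LinearMap.id
          (L.coactMax.toLinearMap.lTensor H t)) := by
    intro t
    induction t with
    | zero => simp
    | add x y hx hy => simp only [map_add, hx, hy]
    | tmul a b => simp
  have e2 : ∀ t : H ⊗[k] C.MaxProl,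
      LinearMap.mul' k _ (TensorProduct.map
        (C.comulMax.toLinearMap ∘ₗ HopfAlgebra.antipode k (A := H)) LinearMap.id
          (TensorProduct.assoc k H H C.MaxProl
            ((Coalgebra.comul (R := k) (A := H)).rTensor C.MaxProl t))) =
      1 ⊗ₜ (LinearMap.mul' k C.MaxProl
        ((C.ofAlg.toLinearMap ∘ₗ HopfAlgebra.antipode k (A := H)).rTensor C.MaxProl t)) := by
    intro t
    induction t with
    | zero => simp
    | add x y hx hy => simp only [map_add, hx, hy, TensorProduct.tmul_add]
    | tmul a b =>
      have e3 : ∀ s : H ⊗[k] H, LinearMap.mul' k _ (TensorProduct.map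
          (C.comulMax.toLinearMap ∘ₗ HopfAlgebra.antipode k (A := H)) LinearMap.id
          (TensorProduct.assoc k H H C.MaxProl (s ⊗ₜ b))) =
          LinearMap.mul' k (H ⊗[k] C.MaxProl) (TensorProduct.map
            (C.comulMax.toLinearMap ∘ₗ HopfAlgebra.antipode k (A := H))
            (Algebra.TensorProduct.includeLeft : H →ₐ[k] H ⊗[k] C.MaxProl).toLinearMap s) *
            (1 ⊗ₜ b) := by
        intro s
        induction s with
        | zero => simp
        | add x y hx hy => simp only [map_add, TensorProduct.add_tmul, add_mul, hx, hy]
        | tmul g h => simp [mul_assoc]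
      rw [LinearMap.rTensor_tmul, e3, antipode_comulMax]
      simp
  have := e1 (L.coactMax x)
  rw [← coactMax_coassoc, e2] at this
  exact this

/-- The projection `π_inv : Γ^∧ → Λ^•`, `π_inv ω = S(ω₋₁) ω₀`. -/
noncomputable def piInv : C.MaxProl →ₗ[k] L.inv :=
  L.piInvAux.codRestrict (Subalgebra.toSubmodule L.inv) L.piInvAux_mem

end LeftCovariant
end covariance
end FODC
end NCG

namespace NCG
namespace FODC

section invariant

variable {k H Γ : Type*} [Field k] [Ring H] [HopfAlgebra k H] [AddCommGroup Γ] [Module k Γ]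
    [Module H Γ] [Module Hᵐᵒᵖ Γ] [SMulCommClass H Hᵐᵒᵖ Γ] [IsScalarTower k H Γ]
    [IsScalarTower k Hᵐᵒᵖ Γ] {C : FODC k H Γ}

namespace LeftCovariant

variable (L : C.LeftCovariant)

variable (C) in
/-- The map `(ω, h) ↦ S(h₁) ω h₂` on `Γ^∧`. -/
noncomputable def hookAux : C.MaxProl →ₗ[k] H →ₗ[k] C.MaxProl :=
  LinearMap.mk₂ k (fun ω h => LinearMap.mul' k C.MaxProl (TensorProduct.map
      (C.ofAlg.toLinearMap ∘ₗ HopfAlgebra.antipode k (A := H))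
      (LinearMap.mul k C.MaxProl ω ∘ₗ C.ofAlg.toLinearMap) (Coalgebra.comul (R := k) h)))
    (by intro x y h; simp [TensorProduct.map_add_right, LinearMap.add_comp])
    (by intro c x h; simp [TensorProduct.map_smul_right, LinearMap.smul_comp])
    (by intro x h h'; simp)
    (by intro c x h; simp)

theorem hookAux_eq {θ : C.MaxProl} (hθ : θ ∈ L.inv) (h : H) :
    hookAux C θ h = L.piInvAux (θ * C.ofAlg h) := by
  simp only [hookAux, LinearMap.mk₂_apply, piInvAux, LinearMap.comp_apply, AlgHom.toLinearMap_apply,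
    map_mul, coactMax_ofAlg, comulMax_apply, L.mem_inv.1 hθ]
  generalize (Coalgebra.comul (R := k) h) = s
  induction s with
  | zero => simp
  | add x y hx hy => simp only [map_add, mul_add, hx, hy]
  | tmul a b => simp

/-- The right action of `H` on `Λ^•`, `θ ↼ h = S(h₁) θ h₂`. -/
noncomputable def hook : L.inv →ₗ[k] H →ₗ[k] L.inv :=
  LinearMap.mk₂ k (fun θ h => ⟨hookAux C θ h, by
      rw [L.hookAux_eq θ.2]; exact L.piInvAux_mem _⟩)
    (by intro x y h; ext; simp) (by intro c x h; ext; simp)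
    (by intro x h h'; ext; simp) (by intro c x h; ext; simp)

@[simp] theorem coe_hook (θ : L.inv) (h : H) : (L.hook θ h : C.MaxProl) = hookAux C θ h := rfl

variable (C) in
/-- The map `h ↦ S(h₁) d h₂` to `Γ^∧`. -/
noncomputable def varpiAux : H →ₗ[k] C.MaxProl :=
  LinearMap.mul' k C.MaxProl ∘ₗ TensorProduct.map
      (C.ofAlg.toLinearMap ∘ₗ HopfAlgebra.antipode k (A := H))
      (C.ofForm ∘ₗ C.d) ∘ₗ Coalgebra.comul (R := k)

theorem varpiAux_eq (h : H) : varpiAux C h = L.piInvAux (C.ofForm (C.d h)) := by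
  simp only [varpiAux, piInvAux, LinearMap.comp_apply, AlgHom.toLinearMap_apply, coactMax_d]
  rw [← LinearMap.comp_apply (LinearMap.rTensor _ _), LinearMap.rTensor_comp_lTensor]

/-- The Maurer–Cartan form `ϖ(h) = S(h₁) d h₂`. -/
noncomputable def varpi : H →ₗ[k] L.inv :=
  (varpiAux C).codRestrict (Subalgebra.toSubmodule L.inv) (by
    intro h; rw [L.varpiAux_eq]; exact L.piInvAux_mem _)

@[simp] theorem coe_varpi (h : H) : (L.varpi h : C.MaxProl) = varpiAux C h := rfl

variable (k H) in
/-- The projection `π_ε(h) = h - ε(h) 1` of `H` onto the kernel of the counit. -/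
noncomputable def piEps : H →ₗ[k] H :=
  LinearMap.id - Algebra.linearMap k H ∘ₗ Coalgebra.counit

theorem varpi_piEps (h : H) : L.varpi (piEps k H h) = L.varpi h := by
  ext
  simp [piEps, varpiAux, Algebra.algebraMap_eq_smul_one, Algebra.TensorProduct.one_def, d_one]

/-- The differential of `Λ^•`. -/
noncomputable def dInv : L.inv →ₗ[k] L.inv :=
  (C.dMax ∘ₗ L.inv.val.toLinearMap).codRestrict (Subalgebra.toSubmodule L.inv) (by
    intro θ
    change L.coactMax (C.dMax θ) = 1 ⊗ₜ C.dMax θ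
    rw [coactMax_dMax, L.mem_inv.1 θ.2, LinearMap.lTensor_tmul])

@[simp] theorem coe_dInv (θ : L.inv) : (L.dInv θ : C.MaxProl) = C.dMax θ := rfl

/-- `Λ^n`: the left invariant forms of degree `n`. -/
noncomputable def invGr (n : ℕ) : Submodule k L.inv := (C.grMax n).comap L.inv.val.toLinearMap

theorem mem_invGr {n : ℕ} {θ : L.inv} : θ ∈ L.invGr n ↔ (θ : C.MaxProl) ∈ C.grMax n := Iff.rfl

theorem lTensor_mul_mem {m n : ℕ} {x y : H ⊗[k] C.MaxProl}
    (hx : x ∈ LinearMap.range ((C.grMax m).subtype.lTensor H))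
    (hy : y ∈ LinearMap.range ((C.grMax n).subtype.lTensor H)) :
    x * y ∈ LinearMap.range ((C.grMax (m + n)).subtype.lTensor H) := by
  obtain ⟨x, rfl⟩ := hx
  obtain ⟨y, rfl⟩ := hy
  induction x with
  | zero => simp
  | add x y hx hy => rw [map_add, add_mul]; exact add_mem hx hy
  | tmul a b =>
    induction y with
    | zero => simp
    | add x y hx hy => rw [map_add, mul_add]; exact add_mem hx hy
    | tmul a' b' => exact ⟨(a * a') ⊗ₜ ⟨b * b', C.mul_mem_grMax b.2 b'.2⟩, by simp⟩

theorem lTensor_mem_of_range {M : Type*} [AddCommGroup M] [Module k M] {n : ℕ}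
    (f : M →ₗ[k] C.MaxProl) (hf : ∀ x, f x ∈ C.grMax n) (t : H ⊗[k] M) :
    f.lTensor H t ∈ LinearMap.range ((C.grMax n).subtype.lTensor H) := by
  have : f = (C.grMax n).subtype ∘ₗ f.codRestrict _ hf := rfl
  rw [this, LinearMap.lTensor_comp_apply]
  exact ⟨_, rfl⟩

theorem coactMax_mem {n : ℕ} {x : C.MaxProl} (hx : x ∈ C.grMax n) :
    L.coactMax x ∈ LinearMap.range ((C.grMax n).subtype.lTensor H) := by
  refine C.mem_grMax_induction
    (p := fun n x => L.coactMax x ∈ LinearMap.range ((C.grMax n).subtype.lTensor H)) ?_ ?_ ?_ n x hx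
  · intro a
    rw [coactMax_ofAlg, comulMax_apply]
    exact lTensor_mem_of_range _ (fun a => C.ofAlg_mem a) _
  · intro n x y hx hy; rw [map_add]; exact add_mem hx hy
  · intro n x ω _ hx
    rw [map_mul, coactMax_ofForm]
    exact lTensor_mul_mem hx (lTensor_mem_of_range _ (fun a => C.ofForm_mem a) _)

theorem coactMax_proj (n : ℕ) (x : C.MaxProl) :
    L.coactMax (C.dga.proj n x) = (C.dga.proj n).lTensor H (L.coactMax x) := by
  induction x using C.dga.induction with
  | h0 => simp
  | hadd x y hx hy => simp only [map_add, hx, hy]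
  | h m x hx =>
    obtain ⟨t, ht⟩ := L.coactMax_mem hx
    rw [← ht, ← LinearMap.lTensor_comp_apply]
    by_cases h : m = n
    · subst h
      have : C.dga.proj m ∘ₗ (C.grMax m).subtype = (C.grMax m).subtype := by
        ext x; exact C.dga.proj_of_mem x.2
      rw [this, ht, C.dga.proj_of_mem hx]
    · have : C.dga.proj n ∘ₗ (C.grMax m).subtype = 0 := by
        ext x; exact C.dga.proj_of_mem_ne x.2 h
      rw [this, C.dga.proj_of_mem_ne hx h]
      simp

/-- The projection of `Λ^•` to the forms of degree `n`. -/
noncomputable def projInv (n : ℕ) : L.inv →ₗ[k] L.inv :=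
  (C.dga.proj n ∘ₗ L.inv.val.toLinearMap).codRestrict (Subalgebra.toSubmodule L.inv) (by
    intro θ
    change L.coactMax (C.dga.proj n θ) = 1 ⊗ₜ C.dga.proj n θ
    rw [coactMax_proj, L.mem_inv.1 θ.2, LinearMap.lTensor_tmul])

@[simp] theorem coe_projInv (n : ℕ) (θ : L.inv) :
    (L.projInv n θ : C.MaxProl) = C.dga.proj n θ := rfl

theorem mem_iSup_invGr (θ : L.inv) : θ ∈ ⨆ n, L.invGr n := by
  classical
  have : θ = ∑ n ∈ (DirectSum.decompose C.dga.gr (θ : C.MaxProl)).support, L.projInv n θ := by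
    ext
    rw [AddSubmonoidClass.coe_finsetSum]
    exact (DirectSum.sum_support_decompose C.dga.gr (θ : C.MaxProl)).symm
  rw [this]
  exact sum_mem fun n _ => Submodule.mem_iSup_of_mem n (C.dga.proj_mem n θ)

theorem hookAux_mem {n : ℕ} {x : C.MaxProl} (hx : x ∈ C.grMax n) (h : H) :
    hookAux C x h ∈ C.grMax n := by
  simp only [hookAux, LinearMap.mk₂_apply]
  generalize (Coalgebra.comul (R := k) h) = s
  induction s with
  | zero => simp
  | add x y hx hy => rw [map_add, map_add]; exact add_mem hx hy
  | tmul a b =>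
    have := C.mul_mem_grMax (C.ofAlg_mem (HopfAlgebra.antipode k a))
      (C.mul_mem_grMax hx (C.ofAlg_mem b))
    rw [zero_add, add_zero] at this
    exact this

theorem varpiAux_mem (h : H) : varpiAux C h ∈ C.grMax 1 := by
  simp only [varpiAux, LinearMap.comp_apply]
  generalize (Coalgebra.comul (R := k) h) = s
  induction s with
  | zero => simp
  | add x y hx hy => rw [map_add, map_add]; exact add_mem hx hy
  | tmul a b =>
    have := C.mul_mem_grMax (C.ofAlg_mem (HopfAlgebra.antipode k a)) (C.ofForm_mem (C.d b))
    rw [zero_add] at this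
    exact this

end LeftCovariant
end invariant
end FODC
end NCG

namespace NCG

/-- A right `H`-comodule algebra structure on the algebra `A`. -/
structure ComoduleAlgebra (k A H : Type*) [Field k] [Ring A] [Algebra k A] [Ring H]
    [HopfAlgebra k H] where
  coact : A →ₐ[k] A ⊗[k] H
  coassoc : ∀ a, TensorProduct.assoc k A H H (coact.toLinearMap.rTensor H (coact a)) =
    (Coalgebra.comul (R := k) (A := H)).lTensor A (coact a)
  counit : ∀ a, TensorProduct.rid k A
    ((Coalgebra.counit (R := k) (A := H)).lTensor A (coact a)) = a

section bundle

variable {k A H : Type*} [Field k] [Ring A] [Algebra k A]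

section balanced

/-- An algebra as a right module over a subalgebra. -/
instance rightModule (B : Subalgebra k A) : Module (B)ᵐᵒᵖ A :=
  Module.compHom A (RingHom.op B.val.toRingHom)

theorem rightModule_smul (B : Subalgebra k A) (b : B) (a : A) :
    MulOpposite.op b • a = a * b := rfl

instance (B : Subalgebra k A) : IsScalarTower k (B)ᵐᵒᵖ A where
  smul_assoc c b a := by
    obtain ⟨b, rfl⟩ := MulOpposite.op_surjective b
    rw [← MulOpposite.op_smul, rightModule_smul, rightModule_smul]
    simp

variable (B : Subalgebra k A) (X Y : Type*) [AddCommGroup X] [Module k X] [Module (B)ᵐᵒᵖ X]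
  [IsScalarTower k (B)ᵐᵒᵖ X] [AddCommGroup Y] [Module k Y] [Module (B)ᵐᵒᵖ Y]
  [IsScalarTower k (B)ᵐᵒᵖ Y]

/-- The relations `x b ⊗ a = x ⊗ b a`. -/
def balancedRel : Submodule k (X ⊗[k] A) :=
  Submodule.span k {t | ∃ (x : X) (b : B) (a : A),
    t = (MulOpposite.op b • x) ⊗ₜ a - x ⊗ₜ ((b : A) * a)}

/-- The balanced tensor product `X ⊗_B A` of a right `B`-module `X` with `A`, where `B` is a
subalgebra of `A`. -/
abbrev Balanced : Type _ := (X ⊗[k] A) ⧸ balancedRel B X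

variable {X Y} in
/-- `f ⊗_B id` -/
noncomputable def Balanced.map (f : X →ₗ[(B)ᵐᵒᵖ] Y) : Balanced B X →ₗ[k] Balanced B Y :=
  (balancedRel B X).mapQ (balancedRel B Y) ((f.restrictScalars k).rTensor A) (by
    rw [balancedRel, Submodule.span_le]
    rintro _ ⟨x, b, a, rfl⟩
    refine Submodule.subset_span ⟨f x, b, a, ?_⟩
    simp)

end balanced

/-- `0 → X → Y → Z → 0` is a short exact sequence. -/
def IsShortExact {X Y Z : Type*} [Zero Z] (f : X → Y) (g : Y → Z) : Prop :=
  Function.Injective f ∧ Function.Exact f g ∧ Function.Surjective g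

/-- `A` is a faithfully flat left `B`-module: a sequence of right `B`-modules is short exact if and
only if it is after applying `- ⊗_B A`. -/
def IsFaithfullyFlat.{u, v} {k : Type v} {A : Type u} [Field k] [Ring A] [Algebra k A]
    (B : Subalgebra k A) : Prop :=
  ∀ (X Y Z : Type u) [AddCommGroup X] [Module k X] [Module (B)ᵐᵒᵖ X] [IsScalarTower k (B)ᵐᵒᵖ X]
    [AddCommGroup Y] [Module k Y] [Module (B)ᵐᵒᵖ Y] [IsScalarTower k (B)ᵐᵒᵖ Y]
    [AddCommGroup Z] [Module k Z] [Module (B)ᵐᵒᵖ Z] [IsScalarTower k (B)ᵐᵒᵖ Z]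
    (f : X →ₗ[(B)ᵐᵒᵖ] Y) (g : Y →ₗ[(B)ᵐᵒᵖ] Z),
    IsShortExact f g ↔ IsShortExact (Balanced.map B f) (Balanced.map B g)

variable [Ring H] [HopfAlgebra k H] (ρ : ComoduleAlgebra k A H)

namespace ComoduleAlgebra

/-- The subalgebra `B = A^{co H}` of coinvariant elements. -/
noncomputable def coinv : Subalgebra k A :=
  AlgHom.equalizer ρ.coact Algebra.TensorProduct.includeLeft

/-- The canonical map `χ : A ⊗_B A → A ⊗ H`, `a ⊗ a' ↦ a a'₀ ⊗ a'₁`. -/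
noncomputable def canonicalMap : Balanced ρ.coinv A →ₗ[k] A ⊗[k] H :=
  (balancedRel ρ.coinv A).liftQ
    (LinearMap.mul' k (A ⊗[k] H) ∘ₗ TensorProduct.map
      (Algebra.TensorProduct.includeLeft : A →ₐ[k] A ⊗[k] H).toLinearMap ρ.coact.toLinearMap) (by
    rw [balancedRel, Submodule.span_le]
    rintro _ ⟨x, b, a, rfl⟩
    have hb : ρ.coact (b : A) = (b : A) ⊗ₜ 1 := b.2
    rw [SetLike.mem_coe, LinearMap.mem_ker, map_sub, sub_eq_zero, rightModule_smul]
    simp only [LinearMap.comp_apply, TensorProduct.map_tmul, LinearMap.mul'_apply,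
      AlgHom.toLinearMap_apply, map_mul, hb]
    rw [mul_assoc]
    rfl)

/-- `B = A^{co H} ⊆ A` is a quantum principal bundle: a faithfully flat Hopf–Galois extension. -/
def IsPrincipalBundle : Prop :=
  Function.Bijective ρ.canonicalMap ∧ IsFaithfullyFlat ρ.coinv

end ComoduleAlgebra
end bundle

section vertical

variable {k A H Γ : Type*} [Field k] [Ring A] [Algebra k A] [Ring H] [HopfAlgebra k H]
    [AddCommGroup Γ] [Module k Γ]
    [Module H Γ] [Module Hᵐᵒᵖ Γ] [SMulCommClass H Hᵐᵒᵖ Γ] [IsScalarTower k H Γ]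
    [IsScalarTower k Hᵐᵒᵖ Γ] {C : FODC k H Γ} (ρ : ComoduleAlgebra k A H) (L : C.LeftCovariant)

namespace ComoduleAlgebra

/-- The map `a ⊗ x ↦ a₀ ⊗ g(a₁) x` of `A ⊗ P` to itself, for a linear map `g : H → P`. -/
noncomputable def conv {P : Type*} [Ring P] [Algebra k P] (g : H →ₗ[k] P) :
    A ⊗[k] P →ₗ[k] A ⊗[k] P :=
  (LinearMap.mul' k P).lTensor A ∘ₗ (TensorProduct.assoc k A P P).toLinearMap ∘ₗ
    (g.lTensor A ∘ₗ ρ.coact.toLinearMap).rTensor P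

section conv

variable {P : Type*} [Ring P] [Algebra k P] (f g : H →ₗ[k] P)

theorem conv_tmul (a : A) (x : P) :
    ρ.conv g (a ⊗ₜ x) = g.lTensor A (ρ.coact a) * 1 ⊗ₜ x := by
  simp only [conv, LinearMap.comp_apply, LinearMap.rTensor_tmul, AlgHom.toLinearMap_apply]
  generalize ρ.coact a = t
  induction t with
  | zero => simp
  | add x y hx hy =>
    simp only [map_add, TensorProduct.add_tmul, add_mul, hx, hy]
  | tmul a b => simp

theorem conv_mul (y : A ⊗[k] P) (x : P) :
    ρ.conv g (y * 1 ⊗ₜ x) = ρ.conv g y * 1 ⊗ₜ x := by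
  induction y with
  | zero => simp
  | add x y hx hy => simp only [map_add, add_mul, hx, hy]
  | tmul a b => simp [conv_tmul, mul_assoc]

open WithConv in
theorem conv_lTensor (a : A) : ρ.conv g (f.lTensor A (ρ.coact a)) =
    (toConv g * toConv f).ofConv.lTensor A (ρ.coact a) := by
  have e1 : ∀ t : A ⊗[k] H, ρ.conv g (f.lTensor A t) =
      (LinearMap.mul' k P ∘ₗ TensorProduct.map g f).lTensor A (TensorProduct.assoc k A H H
        (ρ.coact.toLinearMap.rTensor H t)) := by
    intro t
    induction t with
    | zero => simp
    | add x y hx hy => simp only [map_add, hx, hy]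
    | tmul a b =>
      rw [LinearMap.lTensor_tmul, conv_tmul, LinearMap.rTensor_tmul, AlgHom.toLinearMap_apply]
      generalize ρ.coact a = s
      induction s with
      | zero => simp
      | add x y hx hy => simp only [map_add, TensorProduct.add_tmul, add_mul, hx, hy]
      | tmul a b => simp
  rw [e1, ρ.coassoc, ← LinearMap.lTensor_comp_apply]
  rfl

theorem conv_conv (y : A ⊗[k] P) : ρ.conv g (ρ.conv f y) =
    ρ.conv (WithConv.toConv g * WithConv.toConv f).ofConv y := by
  induction y with
  | zero => simp
  | add x y hx hy => simp only [map_add, hx, hy]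
  | tmul a b => rw [conv_tmul, conv_mul, conv_lTensor, conv_tmul]

theorem conv_one (y : A ⊗[k] P) :
    ρ.conv (1 : WithConv (H →ₗ[k] P)).ofConv y = y := by
  induction y with
  | zero => simp
  | add x y hx hy => simp only [map_add, hx, hy]
  | tmul a b =>
    rw [conv_tmul]
    have : ∀ t : A ⊗[k] H, (1 : WithConv (H →ₗ[k] P)).ofConv.lTensor A t =
        (TensorProduct.rid k A ((Coalgebra.counit (R := k) (A := H)).lTensor A t)) ⊗ₜ 1 := by
      intro t
      induction t with
      | zero => simp
      | add x y hx hy => simp only [map_add, TensorProduct.add_tmul, hx, hy]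
      | tmul a b => simp [LinearMap.convOne_def, Algebra.algebraMap_eq_smul_one,
          TensorProduct.smul_tmul]
    rw [this, ρ.counit]
    simp

end conv

end ComoduleAlgebra

open WithConv in
theorem FODC.ofAlg_conv_antipode (C : FODC k H Γ) : toConv C.ofAlg.toLinearMap *
    toConv (C.ofAlg.toLinearMap ∘ₗ HopfAlgebra.antipode k (A := H)) = 1 := by
  have := LinearMap.algHom_comp_convMul_distrib C.ofAlg (toConv LinearMap.id)
    (toConv (HopfAlgebra.antipode k (A := H)))
  rw [LinearMap.id_mul_antipode] at this
  apply WithConv.ofConv_injective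
  refine this.symm.trans ?_
  ext x
  simp [LinearMap.convOne_def]

open WithConv in
theorem FODC.antipode_conv_ofAlg (C : FODC k H Γ) :
    toConv (C.ofAlg.toLinearMap ∘ₗ HopfAlgebra.antipode k (A := H)) *
      toConv C.ofAlg.toLinearMap = 1 := by
  have := LinearMap.algHom_comp_convMul_distrib C.ofAlg
    (toConv (HopfAlgebra.antipode k (A := H))) (toConv LinearMap.id)
  rw [LinearMap.antipode_mul_id] at this
  apply WithConv.ofConv_injective
  refine this.symm.trans ?_
  ext x
  simp [LinearMap.convOne_def]

namespace Vert

/-- The product of vertical forms,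
`(a ⊗ θ) ∧ (b ⊗ η) = a b₀ ⊗ (θ ↼ b₁) ∧ η`. -/
noncomputable def vmul : A ⊗[k] L.inv →ₗ[k] A ⊗[k] L.inv →ₗ[k] A ⊗[k] L.inv :=
  TensorProduct.lift (LinearMap.mk₂ k (fun a θ => TensorProduct.lift (LinearMap.mk₂ k
    (fun b η => TensorProduct.map (LinearMap.mul k A a)
      ((LinearMap.mul k L.inv).flip η ∘ₗ L.hook θ) (ρ.coact b))
    (by intro b b' η; simp)
    (by intro c b η; simp)
    (by intro b η η'; simp [LinearMap.add_comp, TensorProduct.map_add_right])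
    (by intro c b η; simp [LinearMap.smul_comp, TensorProduct.map_smul_right])))
    (by intro a a' θ; ext b η; simp [TensorProduct.map_add_left])
    (by intro c a θ; ext b η; simp [TensorProduct.map_smul_left])
    (by intro a θ θ'; ext b η; simp [LinearMap.comp_add, TensorProduct.map_add_right])
    (by intro c a θ; ext b η; simp [LinearMap.comp_smul, TensorProduct.map_smul_right]))

theorem vmul_tmul (a b : A) (θ η : L.inv) : vmul ρ L (a ⊗ₜ θ) (b ⊗ₜ η) =
    TensorProduct.map (LinearMap.mul k A a) ((LinearMap.mul k L.inv).flip η ∘ₗ L.hook θ)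
      (ρ.coact b) := by
  simp [vmul]

/-- The differential of vertical forms,
`d (a ⊗ θ) = a ⊗ d θ + a₀ ⊗ ϖ(π_ε(a₁)) ∧ θ`. -/
noncomputable def vd : A ⊗[k] L.inv →ₗ[k] A ⊗[k] L.inv :=
  L.dInv.lTensor A + ρ.conv (L.varpi ∘ₗ FODC.LeftCovariant.piEps k H)

/-- Auxiliary: the injective map `a ⊗ θ ↦ a₀ ⊗ a₁ θ` to the algebra `A ⊗ Γ^∧`. -/
noncomputable def emb : A ⊗[k] L.inv →ₗ[k] A ⊗[k] C.MaxProl :=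
  ρ.conv C.ofAlg.toLinearMap ∘ₗ L.inv.val.toLinearMap.lTensor A

variable (C) in
/-- Auxiliary: the coaction of `A`, as a map to `A ⊗ Γ^∧`. -/
noncomputable def coactP : A →ₐ[k] A ⊗[k] C.MaxProl :=
  (Algebra.TensorProduct.map (AlgHom.id k A) C.ofAlg).comp ρ.coact

theorem coactP_apply (a : A) : coactP C ρ a = C.ofAlg.toLinearMap.lTensor A (ρ.coact a) := rfl

theorem emb_tmul (a : A) (θ : L.inv) : emb ρ L (a ⊗ₜ θ) = coactP C ρ a * 1 ⊗ₜ (θ : C.MaxProl) := by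
  simp [emb, ComoduleAlgebra.conv_tmul, coactP_apply]

theorem emb_injective : Function.Injective (emb ρ L) := by
  refine Function.Injective.comp (g := ρ.conv C.ofAlg.toLinearMap) ?_
    (Module.Flat.lTensor_preserves_injective_linearMap _ Subtype.val_injective)
  refine Function.LeftInverse.injective
    (g := ρ.conv (C.ofAlg.toLinearMap ∘ₗ HopfAlgebra.antipode k (A := H))) fun y => ?_
  rw [ρ.conv_conv, C.antipode_conv_ofAlg, ρ.conv_one]

open WithConv in
theorem mul_coactP (θ : C.MaxProl) (b : A) : (1 ⊗ₜ θ) * coactP C ρ b =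
    ρ.conv C.ofAlg.toLinearMap
      ((FODC.LeftCovariant.hookAux C θ).lTensor A (ρ.coact b)) := by
  have e1 : (1 ⊗ₜ θ) * coactP C ρ b =
      (LinearMap.mul k C.MaxProl θ ∘ₗ C.ofAlg.toLinearMap).lTensor A (ρ.coact b) := by
    rw [coactP_apply]
    generalize ρ.coact b = t
    induction t with
    | zero => simp
    | add x y hx hy => simp only [map_add, mul_add, hx, hy]
    | tmul a b => simp
  have e2 : FODC.LeftCovariant.hookAux C θ =
      (toConv (C.ofAlg.toLinearMap ∘ₗ HopfAlgebra.antipode k (A := H)) *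
        toConv (LinearMap.mul k C.MaxProl θ ∘ₗ C.ofAlg.toLinearMap)).ofConv := rfl
  rw [e1, e2, ρ.conv_lTensor, ← mul_assoc, C.ofAlg_conv_antipode, one_mul]

theorem emb_vmul (v w : A ⊗[k] L.inv) : emb ρ L (vmul ρ L v w) = emb ρ L v * emb ρ L w := by
  induction v with
  | zero => simp
  | add x y hx hy => simp only [map_add, LinearMap.add_apply, add_mul, hx, hy]
  | tmul a θ =>
    induction w with
    | zero => simp
    | add x y hx hy => simp only [map_add, mul_add, hx, hy]
    | tmul b η =>
      have e : ∀ t : A ⊗[k] H, emb ρ L (TensorProduct.map (LinearMap.mul k A a)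
          ((LinearMap.mul k L.inv).flip η ∘ₗ L.hook θ) t) =
          coactP C ρ a * ρ.conv C.ofAlg.toLinearMap
            ((FODC.LeftCovariant.hookAux C θ).lTensor A t) * 1 ⊗ₜ (η : C.MaxProl) := by
        intro t
        induction t with
        | zero => simp
        | add x y hx hy => simp only [map_add, mul_add, add_mul, hx, hy]
        | tmul b h =>
          simp [emb_tmul, ComoduleAlgebra.conv_tmul, ← coactP_apply, mul_assoc]
      rw [vmul_tmul, e, ← mul_coactP, emb_tmul, emb_tmul]
      simp only [mul_assoc]

open WithConv in
theorem emb_vd (v : A ⊗[k] L.inv) : emb ρ L (vd ρ L v) = C.dMax.lTensor A (emb ρ L v) := by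
  induction v with
  | zero => simp
  | add x y hx hy => simp only [map_add, hx, hy]
  | tmul a θ =>
    have e0 : L.varpi ∘ₗ FODC.LeftCovariant.piEps k H = L.varpi :=
      LinearMap.ext fun h => L.varpi_piEps h
    have e1 : L.inv.val.toLinearMap.lTensor A (L.varpi.lTensor A (ρ.coact a) * 1 ⊗ₜ θ) =
        (FODC.LeftCovariant.varpiAux C).lTensor A (ρ.coact a) * 1 ⊗ₜ (θ : C.MaxProl) := by
      generalize ρ.coact a = t
      induction t with
      | zero => simp
      | add x y hx hy => simp only [map_add, add_mul, hx, hy]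
      | tmul a b => simp
    have e2 : FODC.LeftCovariant.varpiAux C =
      (toConv (C.ofAlg.toLinearMap ∘ₗ HopfAlgebra.antipode k (A := H)) *
        toConv (C.ofForm ∘ₗ C.d)).ofConv := rfl
    have e3 : (C.parity.toLinearMap).lTensor A (coactP C ρ a) = coactP C ρ a := by
      rw [coactP_apply, ← LinearMap.lTensor_comp_apply]
      congr 1
      congr 1
      ext x
      simp
    have e4 : C.dMax.lTensor A (coactP C ρ a) = (C.ofForm ∘ₗ C.d).lTensor A (ρ.coact a) := by
      rw [coactP_apply, ← LinearMap.lTensor_comp_apply]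
      congr 1
      congr 1
      ext x
      simp
    have e5 : emb ρ L (ρ.conv L.varpi (a ⊗ₜ θ)) =
        (C.ofForm ∘ₗ C.d).lTensor A (ρ.coact a) * 1 ⊗ₜ (θ : C.MaxProl) := by
      rw [emb, LinearMap.comp_apply, ρ.conv_tmul, e1, ρ.conv_mul, e2, ρ.conv_lTensor,
        toConv_ofConv, ← mul_assoc, C.ofAlg_conv_antipode, one_mul]
    rw [vd, e0, LinearMap.add_apply, map_add, e5, LinearMap.lTensor_tmul, emb_tmul, emb_tmul,
      FODC.LeftCovariant.lTensor_dMax_mul, e3, e4]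
    simp [add_comm]

end Vert
end vertical
end NCG

namespace NCG

section vertical

variable {k A H Γ : Type*} [Field k] [Ring A] [Algebra k A] [Ring H] [HopfAlgebra k H]
    [AddCommGroup Γ] [Module k Γ]
    [Module H Γ] [Module Hᵐᵒᵖ Γ] [SMulCommClass H Hᵐᵒᵖ Γ] [IsScalarTower k H Γ]
    [IsScalarTower k Hᵐᵒᵖ Γ] {C : FODC k H Γ}

/-- The space `ver^•(A) = A ⊗ Λ^•` of vertical forms. -/
def Vert (_ : ComoduleAlgebra k A H) (L : C.LeftCovariant) : Type _ := A ⊗[k] L.inv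

namespace Vert

variable (ρ : ComoduleAlgebra k A H) (L : C.LeftCovariant)

noncomputable instance addCommGroup : AddCommGroup (Vert ρ L) := inferInstanceAs (AddCommGroup (A ⊗[k] L.inv))
noncomputable instance module : Module k (Vert ρ L) := inferInstanceAs (Module k (A ⊗[k] L.inv))

/-- The vertical forms as a tensor product. -/
noncomputable def equiv : A ⊗[k] L.inv ≃ₗ[k] Vert ρ L := LinearEquiv.refl k _

/-- Auxiliary: the embedding of the vertical forms in the algebra `A ⊗ Γ^∧`. -/
noncomputable def toP : Vert ρ L →ₗ[k] A ⊗[k] C.MaxProl := emb ρ L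

theorem toP_injective : Function.Injective (toP ρ L) := emb_injective ρ L

noncomputable instance mulInst : Mul (Vert ρ L) := ⟨fun v w => vmul ρ L v w⟩
noncomputable instance oneInst : One (Vert ρ L) := ⟨equiv ρ L (1 ⊗ₜ 1)⟩

theorem mul_def (v w : A ⊗[k] L.inv) :
    equiv ρ L v * equiv ρ L w = equiv ρ L (vmul ρ L v w) := rfl

theorem toP_mul (v w : Vert ρ L) : toP ρ L (v * w) = toP ρ L v * toP ρ L w :=
  emb_vmul ρ L v w

theorem toP_one : toP ρ L 1 = 1 := by
  change emb ρ L (1 ⊗ₜ 1) = 1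
  rw [emb_tmul, map_one, one_mul]
  rfl

noncomputable instance ring : Ring (Vert ρ L) :=
  { addCommGroup ρ L, mulInst ρ L, oneInst ρ L with
    left_distrib := fun v w w' => (vmul ρ L v).map_add w w'
    right_distrib := fun v v' w => (vmul ρ L).map_add₂ v v' w
    zero_mul := fun v => (vmul ρ L).map_zero₂ v
    mul_zero := fun v => (vmul ρ L v).map_zero
    mul_assoc := fun u v w => toP_injective ρ L (by simp only [toP_mul, mul_assoc])
    one_mul := fun v => toP_injective ρ L (by simp only [toP_mul, toP_one, one_mul])
    mul_one := fun v => toP_injective ρ L (by simp only [toP_mul, toP_one, mul_one]) }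

noncomputable instance algebra : Algebra k (Vert ρ L) :=
  Algebra.ofModule
    (fun c v w => (vmul ρ L).map_smul₂ c v w)
    (fun c v w => (vmul ρ L v).map_smul c w)

/-- The forms of degree `n`: `ver^n(A) = A ⊗ Λ^n`. -/
noncomputable def gr (n : ℕ) : Submodule k (Vert ρ L) :=
  (LinearMap.range ((L.invGr n).subtype.lTensor A)).map (equiv ρ L).toLinearMap

theorem tmul_mem_gr {n : ℕ} (a : A) {θ : L.inv} (h : θ ∈ L.invGr n) :
    equiv ρ L (a ⊗ₜ θ) ∈ gr ρ L n :=
  ⟨a ⊗ₜ θ, ⟨a ⊗ₜ ⟨θ, h⟩, rfl⟩, rfl⟩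

theorem gr_induction {n : ℕ} {p : ∀ x, x ∈ gr ρ L n → Prop}
    (h : ∀ (a : A) (θ : L.inv) (hθ : θ ∈ L.invGr n), p _ (tmul_mem_gr ρ L a hθ))
    (h0 : p 0 (zero_mem _))
    (hadd : ∀ x y hx hy, p x hx → p y hy → p (x + y) (add_mem hx hy)) {x : Vert ρ L}
    (hx : x ∈ gr ρ L n) : p x hx := by
  have key : ∀ t : A ⊗[k] L.invGr n, ∃ h', p (equiv ρ L ((L.invGr n).subtype.lTensor A t)) h' := by
    intro t
    induction t with
    | zero => simpa using h0
    | add x y hx hy =>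
      obtain ⟨hx, hx'⟩ := hx
      obtain ⟨hy, hy'⟩ := hy
      simp only [map_add]
      exact ⟨add_mem hx hy, hadd _ _ hx hy hx' hy'⟩
    | tmul a θ => exact ⟨_, h a θ θ.2⟩
  obtain ⟨_, ⟨t, rfl⟩, rfl⟩ := hx
  exact (key t).2

/-- The differential of vertical forms. -/
noncomputable def d : Vert ρ L →ₗ[k] Vert ρ L :=
  (equiv ρ L).toLinearMap ∘ₗ vd ρ L ∘ₗ (equiv ρ L).symm.toLinearMap

theorem toP_d (v : Vert ρ L) : toP ρ L (d ρ L v) = C.dMax.lTensor A (toP ρ L v) := emb_vd ρ L v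

theorem lTensor_parity_toP {n : ℕ} {v : Vert ρ L} (hv : v ∈ gr ρ L n) :
    C.parity.toLinearMap.lTensor A (toP ρ L v) = (-1 : k) ^ n • toP ρ L v := by
  induction hv using gr_induction with
  | h0 => simp
  | hadd x y _ _ hx hy => simp only [map_add, hx, hy, smul_add]
  | h a θ h =>
    change C.parity.toLinearMap.lTensor A (emb ρ L (a ⊗ₜ θ)) = (-1 : k) ^ n • emb ρ L (a ⊗ₜ θ)
    rw [emb_tmul, coactP_apply]
    generalize ρ.coact a = t
    induction t with
    | zero => simp
    | add x y hx hy => simp only [map_add, add_mul, hx, hy, smul_add]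
    | tmul a b =>
      have := C.parity_of_mem n _ (L.mem_invGr.1 h)
      simp [this]

theorem map_mem {m n : ℕ} (a : A) {θ η : L.inv} (hθ : θ ∈ L.invGr m) (hη : η ∈ L.invGr n)
    (t : A ⊗[k] H) : equiv ρ L (TensorProduct.map (LinearMap.mul k A a)
      ((LinearMap.mul k L.inv).flip η ∘ₗ L.hook θ) t) ∈ gr ρ L (m + n) := by
  induction t with
  | zero => simp
  | add x y hx hy => simp only [map_add]; exact add_mem hx hy
  | tmul b h =>
    exact tmul_mem_gr ρ L _ (C.mul_mem_grMax (FODC.LeftCovariant.hookAux_mem hθ h) hη)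

theorem mul_mem {m n : ℕ} {v w : Vert ρ L} (hv : v ∈ gr ρ L m) (hw : w ∈ gr ρ L n) :
    v * w ∈ gr ρ L (m + n) := by
  induction hv using gr_induction with
  | h0 => simp
  | hadd x y _ _ hx hy => rw [add_mul]; exact add_mem hx hy
  | h a θ hθ =>
    induction hw using gr_induction with
    | h0 => simp
    | hadd x y _ _ hx hy => rw [mul_add]; exact add_mem hx hy
    | h b η hη =>
      rw [mul_def, vmul_tmul]
      exact map_mem ρ L a hθ hη _

theorem d_mem {n : ℕ} {v : Vert ρ L} (hv : v ∈ gr ρ L n) : d ρ L v ∈ gr ρ L (n + 1) := by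
  induction hv using gr_induction with
  | h0 => simp
  | hadd x y _ _ hx hy => rw [map_add]; exact add_mem hx hy
  | h a θ hθ =>
    change equiv ρ L (vd ρ L (a ⊗ₜ θ)) ∈ _
    rw [vd, LinearMap.add_apply, map_add, LinearMap.lTensor_tmul, ρ.conv_tmul]
    refine add_mem (tmul_mem_gr ρ L a (C.dMax_mem n _ hθ)) ?_
    generalize ρ.coact a = t
    induction t with
    | zero => simp
    | add x y hx hy => simp only [map_add, add_mul]; exact add_mem hx hy
    | tmul b h =>
      have := C.mul_mem_grMax (FODC.LeftCovariant.varpiAux_mem (C := C)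
        (FODC.LeftCovariant.piEps k H h)) hθ
      rw [add_comm] at this
      simp only [LinearMap.lTensor_tmul, Algebra.TensorProduct.tmul_mul_tmul, mul_one]
      exact tmul_mem_gr ρ L _ this

/-- The vertical forms as a differential graded algebra. -/
noncomputable def dga : DGA k (Vert ρ L) where
  gr := gr ρ L
  gradedMonoid :=
    { one_mem := tmul_mem_gr ρ L 1 (by
        change (1 : C.MaxProl) ∈ C.grMax 0
        rw [← map_one C.ofAlg]; exact C.ofAlg_mem 1)
      mul_mem := fun _ _ _ _ => mul_mem ρ L }
  isInternal := by
    refine isInternal_of_proj _ (fun n => (equiv ρ L).toLinearMap ∘ₗ (L.projInv n).lTensor A ∘ₗ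
      (equiv ρ L).symm.toLinearMap) ?_ ?_ ?_
    · intro n x hx
      induction hx using gr_induction with
      | h0 => simp
      | hadd x y _ _ hx hy => rw [map_add, hx, hy]
      | h a θ h =>
        have : L.projInv n θ = θ := Subtype.ext (C.dga.proj_of_mem h)
        simp [this]
    · intro n m x hx hne
      induction hx using gr_induction with
      | h0 => simp
      | hadd x y _ _ hx hy => rw [map_add, hx, hy, add_zero]
      | h a θ h =>
        have : L.projInv n θ = 0 := Subtype.ext (C.dga.proj_of_mem_ne h hne)
        simp [this]
    · intro x
      obtain ⟨t, rfl⟩ := (equiv ρ L).surjective x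
      induction t with
      | zero => simp
      | add x y hx hy => rw [map_add]; exact add_mem hx hy
      | tmul a θ =>
        have := L.mem_iSup_invGr θ
        induction this using Submodule.iSup_induction' with
        | zero => simp
        | add x y _ _ hx hy => rw [TensorProduct.tmul_add, map_add]; exact add_mem hx hy
        | mem n x hx => exact Submodule.mem_iSup_of_mem n (tmul_mem_gr ρ L a hx)
  d := d ρ L
  d_mem := d_mem ρ L
  d_d := fun v => toP_injective ρ L (by
    rw [toP_d, toP_d, ← LinearMap.lTensor_comp_apply, map_zero]
    have : C.dMax ∘ₗ C.dMax = 0 := LinearMap.ext C.dMax_dMax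
    rw [this]; simp)
  leibniz := fun {n x} hx y => toP_injective ρ L (by
    rw [toP_d, toP_mul, FODC.LeftCovariant.lTensor_dMax_mul, lTensor_parity_toP ρ L hx, map_add,
      map_smul, toP_mul, toP_mul, toP_d, toP_d, smul_mul_assoc])

/-- The inclusion `A → ver^•(A)`, `a ↦ a ⊗ 1`. -/
noncomputable def ofAlg : A →ₐ[k] Vert ρ L :=
  AlgHom.ofLinearMap ((equiv ρ L).toLinearMap ∘ₗ (TensorProduct.mk k A L.inv).flip 1) rfl
    (fun a b => toP_injective ρ L (by
      rw [toP_mul]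
      change emb ρ L ((a * b) ⊗ₜ 1) = emb ρ L (a ⊗ₜ 1) * emb ρ L (b ⊗ₜ 1)
      have e : ∀ c : A, emb ρ L (c ⊗ₜ 1) = coactP C ρ c := fun c => by
        rw [emb_tmul]; exact mul_one _
      rw [e, e, e, map_mul]))

end Vert

section calculus

variable {Ω Ω' : Type*} [Ring Ω] [Algebra k Ω] [Ring Ω'] [Algebra k Ω']

/-- The differential graded algebra `D`, with the inclusion `ι` of `A`, is a differential calculus
over `A`: one has `Ω^0 = A`, and `Ω^n` is spanned by all `a⁰ d a¹ ∧ ⋯ ∧ d aⁿ`. -/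
structure DGA.IsCalculus (D : DGA k Ω) (ι : A →ₐ[k] Ω) : Prop where
  injective : Function.Injective ι
  range : LinearMap.range ι.toLinearMap = D.gr 0
  span : ∀ n, D.gr n = Submodule.span k {ω | ∃ (a₀ : A) (a : Fin n → A),
    ω = ι a₀ * (List.ofFn fun i => D.d (ι (a i))).prod}

/-- The morphism `f : Ω^•(A) → Ω^•(A) ⊗ Ω^•(H)` extends the coaction of `A`. -/
def ExtendsCoact (ρ : ComoduleAlgebra k A H) {D : DGA k Ω} (ι : A →ₐ[k] Ω)
    (f : D.Hom (D.tensor C.dga)) : Prop :=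
  ∀ a : A, f.toAlgHom (ι a) = GradedTensorProduct.of k D.gr C.dga.gr
    (TensorProduct.map ι.toLinearMap C.ofAlg.toLinearMap (ρ.coact a))

variable (C) in
/-- A complete differential calculus over `A`: the coaction of `A` extends to a morphism
`Ω^•(A) → Ω^•(A) ⊗ Ω^•(H)` of differential graded algebras. -/
def DGA.IsComplete (ρ : ComoduleAlgebra k A H) (D : DGA k Ω) (ι : A →ₐ[k] Ω) : Prop :=
  D.IsCalculus ι ∧ ∃ f : D.Hom (D.tensor C.dga), ExtendsCoact ρ ι f

/-- The projection `Ω^•(A) → Ω^0(A) = A` of a differential calculus. -/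
noncomputable def DGA.IsCalculus.proj₀ {D : DGA k Ω} {ι : A →ₐ[k] Ω} (h : D.IsCalculus ι) :
    Ω →ₗ[k] A :=
  (LinearEquiv.ofBijective (ι.toLinearMap.codRestrict (D.gr 0) fun a => by
      rw [← h.range]; exact ⟨a, rfl⟩)
    ⟨fun a b hab => h.injective congr(($hab : Ω)), fun ω => by
      obtain ⟨a, ha⟩ : (ω : Ω) ∈ LinearMap.range ι.toLinearMap := by rw [h.range]; exact ω.2
      exact ⟨a, Subtype.ext ha⟩⟩).symm.toLinearMap ∘ₗ
  (D.proj 0).codRestrict (D.gr 0) (D.proj_mem 0)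

/-- The vertical projection `π_ver : Ω^•(A) → ver^•(A)`. On `Ω^n(A)` it is
`(id ⊗ π_inv ∘ π_n) ∘ Δ_A^∧`: the component of `Δ_A^∧ ω` in `Ω^0(A) ⊗ Ω^n(H) = A ⊗ Ω^n(H)` is
mapped to `A ⊗ Λ^n` by `id ⊗ π_inv`. -/
noncomputable def piVer (ρ : ComoduleAlgebra k A H) (L : C.LeftCovariant) {D : DGA k Ω}
    {ι : A →ₐ[k] Ω} (h : D.IsCalculus ι) (Δ : D.Hom (D.tensor C.dga)) : Ω →ₗ[k] Vert ρ L :=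
  (Vert.equiv ρ L).toLinearMap ∘ₗ TensorProduct.map h.proj₀ L.piInv ∘ₗ
    (GradedTensorProduct.of k D.gr C.dga.gr).symm.toLinearMap ∘ₗ Δ.toAlgHom.toLinearMap

/-- The map `f ⊗ id : Ω ⊗ Ω^•(H) → Ω' ⊗ Ω^•(H)` for a linear map `f`. -/
noncomputable def mapTensorId (D : DGA k Ω) (D' : DGA k Ω') (f : Ω →ₗ[k] Ω') :
    D.Tensor C.dga →ₗ[k] D'.Tensor C.dga :=
  (GradedTensorProduct.of k D'.gr C.dga.gr).toLinearMap ∘ₗ f.rTensor C.MaxProl ∘ₗ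
    (GradedTensorProduct.of k D.gr C.dga.gr).symm.toLinearMap

end calculus
end vertical
end NCG

open NCG

/-!
# The vertical forms of a quantum principal bundle

A differential calculus is generated by `A` and `d A`. Hence a morphism of differential graded
algebras out of it is determined by its values on `A` (`DGA.IsCalculus.algHom_ext`), an algebra map
out of it is compatible with the differentials and the degrees as soon as it is on `A`
(`DGA.IsCalculus.hom`), and its range lies in any subalgebra that contains the images of `A` and of
`d A` (`DGA.IsCalculus.map_mem_subalgebra`). Everything below is reduced to the algebra `A` in this
way.

*The vertical forms are a calculus* (`Vert.isCalculus`). The formula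
`π_inv(ω d b) = (π_inv(ω) ↼ b₁) ϖ(b₂)` shows that `Λ^{n+1} = Λ^n ϖ(H)`, and surjectivity of the
canonical map `χ` writes each `a ⊗ ϖ(h)` as a sum of forms `b d b'`, because
`b d b' = b b'₀ ⊗ ϖ(b'₁)`. This gives `ver^{n+1}(A) = ver^n(A) d A`. In degree zero, `Λ^0 = k`.

*The coaction* (`Vert.coactHom`). Bicovariance makes `Γ^∧` a differential graded bialgebra: its
coproduct `Δ^∧` extends that of `H` and is the sum of the two coactions on `Γ` (`FODC.comulHom`).
The map `a ⊗ θ ↦ a₀ ⊗ a₁ θ` embeds `ver^•(A)` in `A ⊗ Γ^∧`, hence `ver^•(A) ⊗ Γ^∧` in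
`A ⊗ (Γ^∧ ⊗ Γ^∧)`. The map `id ⊗ Δ^∧` takes `A` and `d A`, and therefore all of `ver^•(A)`, into
the image of this embedding, and so induces the coaction.

*The vertical projection* (`piVerHom`). The component of `Δ_A^∧ ω` in `Ω^0(A) ⊗ Γ^∧ = A ⊗ Γ^∧`
depends multiplicatively on `ω`, and by generation it lies in the image of `ver^•(A)`. As
`id ⊗ π_inv` inverts the embedding of `ver^•(A)`, it is the image of `π_ver ω`
(`ExtendsCoact.toP_piVer`). So `π_ver` is a morphism of differential graded algebras that is the
identity on `A`. Then both sides of the compatibility between the two coactions are morphisms of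
differential graded algebras, and they agree on `A`.
-/

/-! ### Differential calculi are generated in degree zero -/

namespace NCG
namespace DGA.IsCalculus

variable {k A Ω : Type*} [Field k] [Ring A] [Algebra k A] [Ring Ω] [Algebra k Ω]
  {D : DGA k Ω} {ι : A →ₐ[k] Ω}

/-- A differential calculus is generated by `A` under addition and right multiplication by `d A`. -/
theorem eq_top (h : D.IsCalculus ι) (N : Submodule k Ω) (h0 : ∀ a, ι a ∈ N)
    (hd : ∀ x ∈ N, ∀ a, x * D.d (ι a) ∈ N) : N = ⊤ := by
  have hl : ∀ l : List Ω, (∀ y ∈ l, ∃ a, y = D.d (ι a)) → ∀ x ∈ N, x * l.prod ∈ N := by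
    intro l
    induction l with
    | nil => intro _ x hx; simpa using hx
    | cons y l ih =>
      intro hl x hx
      obtain ⟨a, rfl⟩ := hl y (by simp)
      rw [List.prod_cons, ← mul_assoc]
      exact ih (fun z hz => hl z (by simp [hz])) _ (hd x hx a)
  rw [eq_top_iff, ← D.isInternal.submodule_iSup_eq_top]
  refine iSup_le fun n => ?_
  rw [h.span n, Submodule.span_le]
  rintro _ ⟨a₀, a, rfl⟩
  refine hl _ (fun y hy => ?_) _ (h0 a₀)
  rw [List.mem_ofFn] at hy
  obtain ⟨i, rfl⟩ := hy
  exact ⟨a i, rfl⟩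

/-- A multiplicative map on a differential calculus takes values in any subalgebra that contains
the images of `A` and of `d A`. -/
theorem map_mem_subalgebra (h : D.IsCalculus ι) {X : Type*} [Ring X] [Algebra k X] (F : Ω →ₐ[k] X)
    (S : Subalgebra k X) (h0 : ∀ a, F (ι a) ∈ S) (hd : ∀ a, F (D.d (ι a)) ∈ S) (ω : Ω) :
    F ω ∈ S := by
  have := h.eq_top ((Subalgebra.toSubmodule S).comap F.toLinearMap) h0
    (fun x hx a => by
      change F (x * D.d (ι a)) ∈ S
      rw [map_mul]
      exact S.mul_mem hx (hd a))
  exact (this ▸ Submodule.mem_top : ω ∈ (Subalgebra.toSubmodule S).comap F.toLinearMap)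

/-- Algebra maps on a differential calculus that intertwine the differential with the same map `δ`
are determined by their values on `A`. -/
theorem algHom_ext (h : D.IsCalculus ι) {X : Type*} [Ring X] [Algebra k X] (δ : X → X)
    {F G : Ω →ₐ[k] X} (hF : ∀ ω, F (D.d ω) = δ (F ω)) (hG : ∀ ω, G (D.d ω) = δ (G ω))
    (h0 : ∀ a, F (ι a) = G (ι a)) : F = G := by
  have := h.eq_top (LinearMap.eqLocus F.toLinearMap G.toLinearMap) h0
    (fun x hx a => by
      have hx : F x = G x := hx
      change F (x * D.d (ι a)) = G (x * D.d (ι a))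
      rw [map_mul, map_mul, hx, hF, hG, h0])
  ext ω
  exact (this ▸ Submodule.mem_top : ω ∈ LinearMap.eqLocus F.toLinearMap G.toLinearMap)

theorem algebra_mem (h : D.IsCalculus ι) (a : A) : ι a ∈ D.gr 0 := by
  rw [← h.range]; exact ⟨a, rfl⟩

/-- By the Leibniz rule and `d² = 0`, compatibility with the differential passes from `A` to all
products `a⁰ d a¹ ⋯ d aⁿ`. -/
theorem map_mem_and_map_d (h : D.IsCalculus ι) {X : Type*} [Ring X] [Algebra k X] (E : DGA k X)
    (F : Ω →ₐ[k] X) (h0 : ∀ a, F (ι a) ∈ E.gr 0) (hd : ∀ a, F (D.d (ι a)) = E.d (F (ι a)))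
    {n : ℕ} {x : Ω} (hx : x ∈ D.gr n) : F x ∈ E.gr n ∧ F (D.d x) = E.d (F x) := by
  have hl : ∀ (n : ℕ) (a : Fin n → A) (m : ℕ) (x : Ω), x ∈ D.gr m → F x ∈ E.gr m →
      F (D.d x) = E.d (F x) →
      F (x * (List.ofFn fun i => D.d (ι (a i))).prod) ∈ E.gr (m + n) ∧
      F (D.d (x * (List.ofFn fun i => D.d (ι (a i))).prod)) =
        E.d (F (x * (List.ofFn fun i => D.d (ι (a i))).prod)) := by
    intro n
    induction n with
    | zero => intro a m x _ hF hx; simpa using ⟨hF, hx⟩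
    | succ n ih =>
      intro a m x hm hF hx
      have hda := D.d_mem (h.algebra_mem (a 0))
      have hFda := E.d_mem (h0 (a 0))
      have e : m + (n + 1) = m + 1 + n := by omega
      rw [List.ofFn_succ, List.prod_cons, ← mul_assoc, e]
      refine ih (fun i => a i.succ) (m + 1) _ (SetLike.GradedMul.mul_mem hm hda) ?_ ?_
      · rw [map_mul, hd]
        exact SetLike.GradedMul.mul_mem hF hFda
      · rw [D.leibniz hm, D.d_d, mul_zero, smul_zero, add_zero, map_mul, map_mul, hd, hx,
          E.leibniz hF, E.d_d, mul_zero, smul_zero, add_zero]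
  rw [h.span n] at hx
  induction hx using Submodule.span_induction with
  | zero => simp
  | add x y _ _ hx hy =>
    simp only [map_add]
    exact ⟨add_mem hx.1 hy.1, by rw [hx.2, hy.2]⟩
  | smul c x _ hx =>
    simp only [map_smul]
    exact ⟨Submodule.smul_mem _ _ hx.1, by rw [hx.2]⟩
  | mem x hx =>
    obtain ⟨a₀, a, rfl⟩ := hx
    simpa using hl n a 0 (ι a₀) (h.algebra_mem a₀) (h0 a₀) (hd a₀)

/-- An algebra map on a differential calculus is a morphism of differential graded algebras as soon
as it maps `A` to degree zero and is compatible with the differential on `A`. -/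
def hom (h : D.IsCalculus ι) {X : Type*} [Ring X] [Algebra k X] (E : DGA k X) (F : Ω →ₐ[k] X)
    (h0 : ∀ a, F (ι a) ∈ E.gr 0) (hd : ∀ a, F (D.d (ι a)) = E.d (F (ι a))) : D.Hom E where
  toAlgHom := F
  map_mem hx := (h.map_mem_and_map_d E F h0 hd hx).1
  map_d x := by
    induction x using D.induction with
    | h n x hx => exact (h.map_mem_and_map_d E F h0 hd hx).2
    | h0 => simp
    | hadd x y hx hy => simp only [map_add, hx, hy]

/-- A differential graded algebra with `Ω⁰ = A` is a differential calculus as soon as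
`Ω^{n+1} = Ω^n d A`. -/
theorem of_gr_succ (hi : Function.Injective ι) (hr : LinearMap.range ι.toLinearMap = D.gr 0)
    (hs : ∀ n, D.gr (n + 1) ≤
      Submodule.span k {ω | ∃ x ∈ D.gr n, ∃ a : A, ω = x * D.d (ι a)}) : D.IsCalculus ι where
  injective := hi
  range := hr
  span n := by
    have hmem : ∀ a, ι a ∈ D.gr 0 := fun a => by rw [← hr]; exact ⟨a, rfl⟩
    apply le_antisymm
    · induction n with
      | zero =>
        rw [← hr]
        rintro _ ⟨a, rfl⟩
        exact Submodule.subset_span ⟨a, Fin.elim0, by simp⟩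
      | succ n ih =>
        refine (hs n).trans (Submodule.span_le.2 ?_)
        rintro _ ⟨x, hx, b, rfl⟩
        replace hx := ih hx
        induction hx using Submodule.span_induction with
        | zero => simp
        | add x y _ _ hx hy => rw [add_mul]; exact add_mem hx hy
        | smul c x _ hx => rw [smul_mul_assoc]; exact Submodule.smul_mem _ _ hx
        | mem x hx =>
          obtain ⟨a₀, a, rfl⟩ := hx
          refine Submodule.subset_span ⟨a₀, Fin.snoc a b, ?_⟩
          rw [List.ofFn_succ', List.concat_eq_append, List.prod_append]
          simp [mul_assoc]
    · rw [Submodule.span_le]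
      rintro _ ⟨a₀, a, rfl⟩
      have h1 := SetLike.list_prod_ofFn_mem_graded (A := D.gr) (fun _ : Fin n => 1)
        (fun i => D.d (ι (a i))) (fun i => D.d_mem (hmem (a i)))
      have h2 := SetLike.GradedMul.mul_mem (A := D.gr) (hmem a₀) h1
      simpa using h2

end DGA.IsCalculus
end NCG

/-! ### Left invariant forms -/

namespace NCG
namespace FODC.LeftCovariant

variable {k H Γ : Type*} [Field k] [Ring H] [HopfAlgebra k H] [AddCommGroup Γ] [Module k Γ]
    [Module H Γ] [Module Hᵐᵒᵖ Γ] [SMulCommClass H Hᵐᵒᵖ Γ] [IsScalarTower k H Γ]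
    [IsScalarTower k Hᵐᵒᵖ Γ] {C : FODC k H Γ} (L : C.LeftCovariant)

theorem piInvAux_ofAlg_mul (a : H) {θ : C.MaxProl} (hθ : θ ∈ L.inv) :
    L.piInvAux (C.ofAlg a * θ) = Coalgebra.counit (R := k) a • θ := by
  have e : ∀ s : H ⊗[k] H, LinearMap.mul' k C.MaxProl
      ((C.ofAlg.toLinearMap ∘ₗ HopfAlgebra.antipode k (A := H)).rTensor C.MaxProl
        (C.ofAlg.toLinearMap.lTensor H s * 1 ⊗ₜ θ)) =
      LinearMap.mul' k C.MaxProl (TensorProduct.map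
        (C.ofAlg.toLinearMap ∘ₗ HopfAlgebra.antipode k (A := H)) C.ofAlg.toLinearMap s) * θ := by
    intro s
    induction s with
    | zero => simp
    | add x y hx hy => simp only [map_add, add_mul, hx, hy]
    | tmul a b => simp [mul_assoc]
  have h : LinearMap.mul' k C.MaxProl (TensorProduct.map
      (C.ofAlg.toLinearMap ∘ₗ HopfAlgebra.antipode k (A := H)) C.ofAlg.toLinearMap
        (Coalgebra.comul (R := k) a)) = algebraMap k _ (Coalgebra.counit (R := k) a) :=
    congr(($(C.antipode_conv_ofAlg)).ofConv a)
  simp only [piInvAux, LinearMap.comp_apply, AlgHom.toLinearMap_apply, map_mul, coactMax_ofAlg,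
    comulMax_apply, L.mem_inv.1 hθ]
  rw [e, h, Algebra.algebraMap_eq_smul_one, smul_mul_assoc, one_mul]

theorem piInv_ofAlg_mul (a : H) (θ : L.inv) :
    L.piInv (C.ofAlg a * θ) = Coalgebra.counit (R := k) a • θ :=
  Subtype.ext (L.piInvAux_ofAlg_mul a θ.2)

theorem piInv_coe (θ : L.inv) : L.piInv θ = θ := by
  simpa using L.piInv_ofAlg_mul 1 θ

open WithConv in
/-- `π_inv(ω d b) = (π_inv(ω) ↼ b₁) ϖ(b₂)`. As the antipode reverses products, the left side is
`S(b₁) π_inv(ω) d b₂`, and `d b = b₁ ϖ(b₂)`. -/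
theorem piInvAux_mul_ofForm_d (x : C.MaxProl) (b : H) :
    L.piInvAux (x * C.ofForm (C.d b)) = LinearMap.mul' k C.MaxProl
      (TensorProduct.map (hookAux C (L.piInvAux x)) (varpiAux C) (Coalgebra.comul (R := k) b)) := by
  have e : ∀ (t : H ⊗[k] C.MaxProl) (s : H ⊗[k] H), LinearMap.mul' k C.MaxProl
      ((C.ofAlg.toLinearMap ∘ₗ HopfAlgebra.antipode k (A := H)).rTensor C.MaxProl
        (t * (C.ofForm ∘ₗ C.d).lTensor H s)) =
      LinearMap.mul' k C.MaxProl (TensorProduct.map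
        (C.ofAlg.toLinearMap ∘ₗ HopfAlgebra.antipode k (A := H))
        (LinearMap.mul k C.MaxProl (LinearMap.mul' k C.MaxProl
          ((C.ofAlg.toLinearMap ∘ₗ HopfAlgebra.antipode k (A := H)).rTensor C.MaxProl t)) ∘ₗ
            C.ofForm ∘ₗ C.d) s) := by
    intro t s
    induction s with
    | zero => simp
    | add x y hx hy => simp only [map_add, mul_add, hx, hy]
    | tmul a b =>
      induction t with
      | zero => simp
      | add x y hx hy =>
        simp only [map_add, add_mul, hx, LinearMap.add_comp, TensorProduct.map_add_right, hy,
          LinearMap.add_apply]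
      | tmul c y => simp [HopfAlgebra.antipode_mul_antidistrib, mul_assoc]
  let S := toConv (C.ofAlg.toLinearMap ∘ₗ HopfAlgebra.antipode k (A := H))
  let i := toConv C.ofAlg.toLinearMap
  let δ := toConv (C.ofForm ∘ₗ C.d)
  have hm : ∀ (θ : C.MaxProl) (f g : WithConv (H →ₗ[k] C.MaxProl)),
      toConv (LinearMap.mul k C.MaxProl θ ∘ₗ (f * g).ofConv) =
        toConv (LinearMap.mul k C.MaxProl θ ∘ₗ f.ofConv) * g := by
    intro θ f g
    apply WithConv.ofConv_injective
    ext h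
    change θ * LinearMap.mul' k _ (TensorProduct.map _ _ (Coalgebra.comul (R := k) h)) =
      LinearMap.mul' k _ (TensorProduct.map _ _ (Coalgebra.comul (R := k) h))
    generalize Coalgebra.comul (R := k) h = s
    induction s with
    | zero => simp
    | add x y hx hy => simp only [map_add, mul_add, hx, hy]
    | tmul a b => simp [mul_assoc]
  have key : ∀ θ : C.MaxProl, S * toConv (LinearMap.mul k C.MaxProl θ ∘ₗ C.ofForm ∘ₗ C.d) =
      toConv (hookAux C θ) * toConv (varpiAux C) := by
    intro θ
    have h1 : toConv (hookAux C θ) =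
        S * toConv (LinearMap.mul k C.MaxProl θ ∘ₗ C.ofAlg.toLinearMap) := rfl
    have h2 : toConv (varpiAux C) = S * δ := rfl
    have h3 : δ = i * (S * δ) := by rw [← mul_assoc, C.ofAlg_conv_antipode, one_mul]
    rw [h1, h2, mul_assoc]
    congr 1
    have := hm θ i (S * δ)
    rw [← h3] at this
    exact this
  have hk := congr(($(key (L.piInvAux x))).ofConv b)
  have h0 : L.piInvAux (x * C.ofForm (C.d b)) = LinearMap.mul' k C.MaxProl
      ((C.ofAlg.toLinearMap ∘ₗ HopfAlgebra.antipode k (A := H)).rTensor C.MaxProl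
        (L.coactMax x * (C.ofForm ∘ₗ C.d).lTensor H (Coalgebra.comul (R := k) b))) := by
    rw [← coactMax_d, ← map_mul]; rfl
  rw [h0, e]
  exact hk

theorem piInvAux_mem_grMax {n : ℕ} {x : C.MaxProl} (hx : x ∈ C.grMax n) :
    L.piInvAux x ∈ C.grMax n := by
  obtain ⟨t, ht⟩ := L.coactMax_mem hx
  simp only [piInvAux, LinearMap.comp_apply, AlgHom.toLinearMap_apply, ← ht]
  clear ht
  induction t with
  | zero => simp
  | add x y hx hy => simp only [map_add]; exact add_mem hx hy
  | tmul a y =>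
    have := C.mul_mem_grMax (C.ofAlg_mem (HopfAlgebra.antipode k a)) y.2
    rw [zero_add] at this
    simpa using this

theorem piInv_mul_ofForm_d (x : C.MaxProl) (b : H) :
    L.piInv (x * C.ofForm (C.d b)) = LinearMap.mul' k L.inv
      (TensorProduct.map (L.hook (L.piInv x)) L.varpi (Coalgebra.comul (R := k) b)) := by
  have e : ∀ s : H ⊗[k] H, LinearMap.mul' k C.MaxProl
      (TensorProduct.map (hookAux C (L.piInvAux x)) (varpiAux C) s) =
        L.inv.val (LinearMap.mul' k L.inv
          (TensorProduct.map (L.hook (L.piInv x)) L.varpi s)) := by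
    intro s
    induction s with
    | zero => simp only [map_zero]
    | add x y hx hy => simp only [map_add, hx, hy]
    | tmul a b => rw [TensorProduct.map_tmul, TensorProduct.map_tmul]; rfl
  exact Subtype.ext ((L.piInvAux_mul_ofForm_d x b).trans (e _))

/-- `Λ^n ϖ(H)` contains `π_inv(Ω^{n+1}(H))`. -/
theorem piInv_mem_span {n : ℕ} {x : C.MaxProl} (hx : x ∈ C.grMax (n + 1)) :
    L.piInv x ∈ Submodule.span k {θ | ∃ η ∈ L.invGr n, ∃ h : H, θ = η * L.varpi h} := by
  rw [grMax_succ] at hx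
  induction hx using Submodule.mul_induction_on' with
  | add x _ y _ hx hy => rw [map_add]; exact add_mem hx hy
  | mem_mul_mem x hx y hy =>
    obtain ⟨ω, rfl⟩ := hy
    induction ω using C.form_induction with
    | h0 => rw [map_zero, mul_zero, map_zero]; exact zero_mem _
    | hadd x y hx hy => rw [map_add, mul_add, map_add]; exact add_mem hx hy
    | h a b =>
      rw [ofForm_smul, ← mul_assoc, piInv_mul_ofForm_d]
      replace hx := C.mul_mem_grMax hx (C.ofAlg_mem a)
      rw [add_zero] at hx
      generalize Coalgebra.comul (R := k) b = s
      induction s with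
      | zero => rw [map_zero, map_zero]; exact zero_mem _
      | add x y hx hy => rw [map_add, map_add]; exact add_mem hx hy
      | tmul c b =>
        exact Submodule.subset_span ⟨_, hookAux_mem (L.piInvAux_mem_grMax hx) c, b, rfl⟩

/-- `Λ^{n+1} = Λ^n ϖ(H)`. -/
theorem invGr_succ_le (n : ℕ) : L.invGr (n + 1) ≤
    Submodule.span k {θ | ∃ η ∈ L.invGr n, ∃ h : H, θ = η * L.varpi h} := by
  intro θ hθ
  rw [← L.piInv_coe θ]
  exact L.piInv_mem_span (L.mem_invGr.1 hθ)

variable (C) in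
/-- The projection of `Γ^∧` to the forms of degree zero, as an algebra map to `H`. -/
noncomputable def maxToAlg : C.MaxProl →ₐ[k] H :=
  C.lift (AlgHom.id k H) 0 (by simp) (by simp) (by simp)

/-- `Λ^0 = k`. -/
theorem exists_smul_one_of_mem_invGr_zero {θ : L.inv} (hθ : θ ∈ L.invGr 0) :
    ∃ c : k, θ = c • 1 := by
  obtain ⟨h, hh⟩ : (θ : C.MaxProl) ∈ LinearMap.range C.ofAlg.toLinearMap := by
    rw [← grMax_zero]; exact hθ
  have hh : C.ofAlg h = θ := hh
  have hθ' := L.mem_inv.1 θ.2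
  rw [← hh, coactMax_ofAlg, comulMax_apply] at hθ'
  have e1 : ∀ s : H ⊗[k] H,
      (Coalgebra.counit (R := k) (A := H) ∘ₗ (maxToAlg C).toLinearMap).lTensor H
        (C.ofAlg.toLinearMap.lTensor H s) = (Coalgebra.counit (R := k) (A := H)).lTensor H s := by
    intro s
    induction s with
    | zero => simp
    | add x y hx hy => simp only [map_add, hx, hy]
    | tmul a b => simp [maxToAlg]
  have h2 := congr((Coalgebra.counit (R := k) (A := H) ∘ₗ (maxToAlg C).toLinearMap).lTensor H $hθ')
  rw [e1, Coalgebra.lTensor_counit_comul] at h2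
  have h3 := congr(TensorProduct.rid k H $h2)
  simp [maxToAlg] at h3
  refine ⟨Coalgebra.counit (R := k) h, Subtype.ext ?_⟩
  rw [← hh]
  conv_lhs => rw [h3]
  simp

end FODC.LeftCovariant
end NCG

/-! ### The vertical forms are a differential calculus -/

namespace NCG
namespace Vert

variable {k A H Γ : Type*} [Field k] [Ring A] [Algebra k A] [Ring H] [HopfAlgebra k H]
    [AddCommGroup Γ] [Module k Γ]
    [Module H Γ] [Module Hᵐᵒᵖ Γ] [SMulCommClass H Hᵐᵒᵖ Γ] [IsScalarTower k H Γ]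
    [IsScalarTower k Hᵐᵒᵖ Γ] {C : FODC k H Γ} (ρ : ComoduleAlgebra k A H) (L : C.LeftCovariant)

theorem toP_ofAlg (a : A) : toP ρ L (ofAlg ρ L a) = coactP C ρ a :=
  (emb_tmul ρ L a 1).trans (mul_one _)

/-- `id ⊗ π_inv` recovers a vertical form from its image in `A ⊗ Γ^∧`. -/
theorem lTensor_piInv_toP (v : Vert ρ L) :
    equiv ρ L (L.piInv.lTensor A (toP ρ L v)) = v := by
  obtain ⟨t, rfl⟩ := (equiv ρ L).surjective v
  congr 1
  change L.piInv.lTensor A (emb ρ L t) = t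
  induction t with
  | zero => simp
  | add x y hx hy => simp only [map_add, hx, hy]
  | tmul a θ =>
    have e : ∀ t : A ⊗[k] H, L.piInv.lTensor A (C.ofAlg.toLinearMap.lTensor A t * 1 ⊗ₜ (θ : C.MaxProl)) =
        TensorProduct.rid k A ((Coalgebra.counit (R := k) (A := H)).lTensor A t) ⊗ₜ θ := by
      intro t
      induction t with
      | zero => simp
      | add x y hx hy => simp only [map_add, add_mul, TensorProduct.add_tmul, hx, hy]
      | tmul a b => simp [L.piInv_ofAlg_mul, TensorProduct.smul_tmul]
    rw [emb_tmul, coactP_apply, e, ρ.counit]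

theorem equiv_tmul (a : A) (θ : L.inv) :
    equiv ρ L (a ⊗ₜ θ) = ofAlg ρ L a * equiv ρ L (1 ⊗ₜ θ) := by
  apply toP_injective ρ L
  rw [toP_mul, toP_ofAlg]
  change emb ρ L (a ⊗ₜ θ) = coactP C ρ a * emb ρ L (1 ⊗ₜ θ)
  rw [emb_tmul, emb_tmul, map_one, one_mul]

theorem equiv_one_tmul_mul (θ η : L.inv) :
    equiv ρ L (1 ⊗ₜ (θ * η)) = equiv ρ L (1 ⊗ₜ θ) * equiv ρ L (1 ⊗ₜ η) := by
  apply toP_injective ρ L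
  rw [toP_mul]
  change emb ρ L (1 ⊗ₜ (θ * η)) = emb ρ L (1 ⊗ₜ θ) * emb ρ L (1 ⊗ₜ η)
  simp [emb_tmul]

theorem d_ofAlg (a : A) : d ρ L (ofAlg ρ L a) = equiv ρ L (L.varpi.lTensor A (ρ.coact a)) := by
  have e0 : L.varpi ∘ₗ FODC.LeftCovariant.piEps k H = L.varpi :=
    LinearMap.ext fun h => L.varpi_piEps h
  have e1 : L.dInv 1 = 0 := by
    ext
    change C.dMax 1 = 0
    rw [← map_one C.ofAlg, FODC.dMax_ofAlg, FODC.d_one, map_zero]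
  change equiv ρ L (vd ρ L (a ⊗ₜ 1)) = _
  rw [vd, e0, LinearMap.add_apply, LinearMap.lTensor_tmul, e1, TensorProduct.tmul_zero, zero_add,
    ρ.conv_tmul]
  congr 1
  exact mul_one _

/-- Surjectivity of the canonical map expresses every `a ⊗ ϖ(h)` through forms `a d b`. -/
theorem equiv_varpi_mem (hρ : Function.Surjective ρ.canonicalMap) (t : A ⊗[k] H) :
    equiv ρ L (L.varpi.lTensor A t) ∈
      Submodule.span k {ω | ∃ a b : A, ω = ofAlg ρ L a * d ρ L (ofAlg ρ L b)} := by
  obtain ⟨s, rfl⟩ := hρ t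
  obtain ⟨s, rfl⟩ := Submodule.Quotient.mk_surjective _ s
  induction s with
  | zero => simp
  | add x y hx hy => simp only [Submodule.Quotient.mk_add, map_add]; exact add_mem hx hy
  | tmul a b =>
    refine Submodule.subset_span ⟨a, b, ?_⟩
    have h : ρ.canonicalMap (Submodule.Quotient.mk (a ⊗ₜ b)) = a ⊗ₜ 1 * ρ.coact b := rfl
    rw [h, d_ofAlg]
    generalize ρ.coact b = t
    induction t with
    | zero => simp
    | add x y hx hy => simp only [map_add, mul_add, hx, hy]
    | tmul b h =>
      simp only [Algebra.TensorProduct.tmul_mul_tmul, one_mul, LinearMap.lTensor_tmul]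
      rw [equiv_tmul, map_mul, mul_assoc, ← equiv_tmul]

theorem ofAlg_mem (a : A) : ofAlg ρ L a ∈ (dga ρ L).gr 0 :=
  tmul_mem_gr ρ L a (by
    change (1 : C.MaxProl) ∈ C.grMax 0
    rw [← map_one C.ofAlg]; exact C.ofAlg_mem 1)

theorem isCalculus (hρ : Function.Surjective ρ.canonicalMap) :
    (dga ρ L).IsCalculus (ofAlg ρ L) := by
  have hmem : ∀ a, ofAlg ρ L a ∈ gr ρ L 0 := ofAlg_mem ρ L
  refine DGA.IsCalculus.of_gr_succ ?_ ?_ ?_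
  · intro a b hab
    -- `a₀ ⊗ a₁` determines `a`, by the counit.
    have h : ∀ a, TensorProduct.rid k A ((Coalgebra.counit (R := k) (A := H) ∘ₗ
        (FODC.LeftCovariant.maxToAlg C).toLinearMap).lTensor A (toP ρ L (ofAlg ρ L a))) = a := by
      intro a
      rw [toP_ofAlg, coactP_apply, ← LinearMap.lTensor_comp_apply]
      convert ρ.counit a
      ext h
      simp [FODC.LeftCovariant.maxToAlg]
    rw [← h a, ← h b, hab]
  · apply le_antisymm
    · rintro _ ⟨a, rfl⟩
      exact hmem a
    · intro v hv
      change v ∈ gr ρ L 0 at hv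
      induction hv using gr_induction with
      | h0 => simp
      | hadd x y _ _ hx hy => exact add_mem hx hy
      | h a θ hθ =>
        obtain ⟨c, rfl⟩ := L.exists_smul_one_of_mem_invGr_zero hθ
        exact ⟨c • a, by rw [TensorProduct.tmul_smul, TensorProduct.smul_tmul']; rfl⟩
  · intro n v hv
    change v ∈ gr ρ L (n + 1) at hv
    induction hv using gr_induction with
    | h0 => simp
    | hadd x y _ _ hx hy => exact add_mem hx hy
    | h a θ hθ =>
      replace hθ := L.invGr_succ_le n hθ
      induction hθ using Submodule.span_induction with
      | zero => simp
      | add x y _ _ hx hy => rw [TensorProduct.tmul_add, map_add]; exact add_mem hx hy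
      | smul c x _ hx => rw [TensorProduct.tmul_smul, map_smul]; exact Submodule.smul_mem _ _ hx
      | mem θ hθ =>
        obtain ⟨η, hη, h, rfl⟩ := hθ
        rw [equiv_tmul, equiv_one_tmul_mul, ← mul_assoc, ← equiv_tmul]
        have hv := equiv_varpi_mem ρ L hρ (1 ⊗ₜ h)
        rw [LinearMap.lTensor_tmul] at hv
        generalize equiv ρ L (1 ⊗ₜ L.varpi h) = v at hv
        induction hv using Submodule.span_induction with
        | zero => simp
        | add x y _ _ hx hy => rw [mul_add]; exact add_mem hx hy
        | smul c x _ hx => rw [mul_smul_comm]; exact Submodule.smul_mem _ _ hx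
        | mem v hv =>
          obtain ⟨b, b', rfl⟩ := hv
          refine Submodule.subset_span ⟨equiv ρ L (a ⊗ₜ η) * ofAlg ρ L b, ?_, b', ?_⟩
          · have hab := mul_mem ρ L (tmul_mem_gr ρ L a hη) (hmem b)
            rw [add_zero] at hab
            exact hab
          · rw [mul_assoc]; rfl

end Vert
end NCG

/-! ### Maps into and out of the graded tensor product -/

namespace NCG
namespace DGA

variable {k Ω Ω' : Type*} [Field k] [Ring Ω] [Algebra k Ω] [Ring Ω'] [Algebra k Ω']
  (D : DGA k Ω) (E : DGA k Ω')

theorem tmul_mul_tmul_of_left (a a' : Ω) {b : Ω'} (hb : b ∈ E.gr 0) (b' : Ω') :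
    (a ᵍ⊗ₜ[k] b * a' ᵍ⊗ₜ[k] b' : Tensor D E) = (a * a') ᵍ⊗ₜ[k] (b * b') := by
  induction a' using D.induction with
  | h0 => simp [GradedTensorProduct.tmul]
  | hadd x y hx hy =>
    simp only [GradedTensorProduct.tmul, TensorProduct.add_tmul, map_add, mul_add] at hx hy ⊢
    rw [hx, hy]
  | h n a' ha' => rw [tmul_mul_tmul D E a hb ha', zero_mul, pow_zero, one_smul]

theorem tmul_mul_tmul_of_right (a : Ω) (b : Ω') {a' : Ω} (ha' : a' ∈ D.gr 0) (b' : Ω') :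
    (a ᵍ⊗ₜ[k] b * a' ᵍ⊗ₜ[k] b' : Tensor D E) = (a * a') ᵍ⊗ₜ[k] (b * b') := by
  induction b using E.induction with
  | h0 => simp [GradedTensorProduct.tmul]
  | hadd x y hx hy =>
    simp only [GradedTensorProduct.tmul, TensorProduct.tmul_add, map_add, add_mul] at hx hy ⊢
    rw [hx, hy]
  | h n b hb => rw [tmul_mul_tmul D E a hb ha', mul_zero, pow_zero, one_smul]

section
variable {B B' : Type*} [Ring B] [Algebra k B] [Ring B'] [Algebra k B']

/-- The algebra map `f ⊗ g : B ⊗ B' → Ω ⊗ Ω'` for algebra maps `f` and `g` with values in degree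
zero. There are no signs, so it is defined on the ordinary tensor product. -/
noncomputable def tensorMapZero (f : B →ₐ[k] Ω) (g : B' →ₐ[k] Ω') (hf : ∀ b, f b ∈ D.gr 0) :
    B ⊗[k] B' →ₐ[k] Tensor D E :=
  AlgHom.ofLinearMap ((GradedTensorProduct.of k D.gr E.gr).toLinearMap ∘ₗ
      TensorProduct.map f.toLinearMap g.toLinearMap)
    (by
      rw [Algebra.TensorProduct.one_def]
      simp only [LinearMap.comp_apply, TensorProduct.map_tmul, AlgHom.toLinearMap_apply, map_one]
      rfl)
    (by
      intro x y
      induction x with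
      | zero => simp
      | add x x' hx hx' => rw [add_mul, map_add, hx, hx', map_add, add_mul]
      | tmul a b =>
        induction y with
        | zero => simp
        | add x x' hx hx' => rw [mul_add, map_add, hx, hx', map_add, mul_add]
        | tmul a' b' =>
          rw [Algebra.TensorProduct.tmul_mul_tmul]
          simp only [LinearMap.comp_apply, TensorProduct.map_tmul, AlgHom.toLinearMap_apply,
            map_mul]
          exact (tmul_mul_tmul_of_right D E _ _ (hf a') _).symm)

theorem tensorMapZero_mem (f : B →ₐ[k] Ω) (g : B' →ₐ[k] Ω') (hf : ∀ b, f b ∈ D.gr 0)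
    (hg : ∀ b, g b ∈ E.gr 0) (t : B ⊗[k] B') : tensorMapZero D E f g hf t ∈ tensorGr D E 0 := by
  induction t with
  | zero => simp
  | add x y hx hy => rw [map_add]; exact add_mem hx hy
  | tmul a b =>
    have h := tmul_mem D E (hf a) (hg b)
    rw [add_zero] at h
    exact h

theorem tensorD_tensorMapZero (f : B →ₐ[k] Ω) (g : B' →ₐ[k] Ω') (hf : ∀ b, f b ∈ D.gr 0)
    (t : B ⊗[k] B') : tensorD D E (tensorMapZero D E f g hf t) =
      GradedTensorProduct.of k D.gr E.gr
        (TensorProduct.map (D.d ∘ₗ f.toLinearMap) g.toLinearMap t +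
          TensorProduct.map f.toLinearMap (E.d ∘ₗ g.toLinearMap) t) := by
  induction t with
  | zero => simp
  | add x y hx hy => simp only [map_add, hx, hy]; abel
  | tmul a b =>
    have := tensorD_tmul D E (hf a) (g b)
    rw [pow_zero, one_smul] at this
    exact this

end

/-- A map of algebras out of the graded tensor product may be checked on homogeneous elements. -/
theorem tensor_map_mul {X : Type*} [Ring X] [Algebra k X] (F : Tensor D E →ₗ[k] X)
    (hF : ∀ (i j : ℕ) (a a' : Ω) (b b' : Ω'), b ∈ E.gr j → a' ∈ D.gr i →
      F ((a * a') ᵍ⊗ₜ[k] (b * b')) =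
        (-1 : k) ^ (j * i) • (F (a ᵍ⊗ₜ[k] b) * F (a' ᵍ⊗ₜ[k] b')))
    (x y : Tensor D E) : F (x * y) = F x * F y := by
  obtain ⟨x, rfl⟩ := (GradedTensorProduct.of k D.gr E.gr).surjective x
  obtain ⟨y, rfl⟩ := (GradedTensorProduct.of k D.gr E.gr).surjective y
  induction x with
  | zero => simp
  | add x x' hx hx' => simp only [map_add, add_mul, hx, hx']
  | tmul a b =>
    induction y with
    | zero => simp
    | add x x' hx hx' => simp only [map_add, mul_add, hx, hx']
    | tmul a' b' =>
      induction b using E.induction with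
      | h0 => simp
      | hadd x y hx hy => simp only [TensorProduct.tmul_add, map_add, add_mul, hx, hy]
      | h j b hb =>
        induction a' using D.induction with
        | h0 => simp
        | hadd x y hx hy => simp only [TensorProduct.add_tmul, map_add, mul_add, hx, hy]
        | h i a' ha' =>
          change F (a ᵍ⊗ₜ[k] b * a' ᵍ⊗ₜ[k] b') = F (a ᵍ⊗ₜ[k] b) * F (a' ᵍ⊗ₜ[k] b')
          have hs : (-1 : k) ^ (j * i) * (-1 : k) ^ (j * i) = 1 := by rw [← mul_pow]; simp
          rw [tmul_mul_tmul D E a hb ha' b', map_smul, hF i j a a' b b' hb ha', smul_smul, hs,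
            one_smul]

end DGA
end NCG

/-! ### The coproduct of the maximal prolongation -/

namespace NCG
namespace FODC

variable {k H Γ : Type*} [Field k] [Ring H] [HopfAlgebra k H] [AddCommGroup Γ] [Module k Γ]
    [Module H Γ] [Module Hᵐᵒᵖ Γ] [SMulCommClass H Hᵐᵒᵖ Γ] [IsScalarTower k H Γ]
    [IsScalarTower k Hᵐᵒᵖ Γ] (C : FODC k H Γ)

theorem ofAlg_injective : Function.Injective C.ofAlg := by
  refine Function.LeftInverse.injective (g := LeftCovariant.maxToAlg C) fun h => ?_
  simp [LeftCovariant.maxToAlg]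

/-- The maximal prolongation is itself a differential calculus over `H`, so that morphisms out of it
may be checked on `H`. -/
theorem dga_isCalculus : C.dga.IsCalculus C.ofAlg := by
  refine DGA.IsCalculus.of_gr_succ C.ofAlg_injective C.grMax_zero.symm fun n => ?_
  change C.grMax (n + 1) ≤ _
  rw [grMax_succ, Submodule.mul_le]
  rintro x hx _ ⟨ω, rfl⟩
  induction ω using C.form_induction with
  | h0 => simp
  | hadd x y hx hy => rw [map_add, mul_add]; exact add_mem hx hy
  | h a b =>
    have hx' := C.mul_mem_grMax hx (C.ofAlg_mem a)
    rw [add_zero] at hx'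
    refine Submodule.subset_span ⟨x * C.ofAlg a, hx', b, ?_⟩
    rw [ofForm_smul, ← mul_assoc]
    exact congrArg _ (C.dMax_ofAlg b).symm

/-- The coproduct of `H`, as a map to `Γ^∧ ⊗ Γ^∧`. -/
noncomputable def comulZero : H →ₐ[k] C.dga.Tensor C.dga :=
  (DGA.tensorMapZero C.dga C.dga C.ofAlg C.ofAlg C.ofAlg_mem).comp (Bialgebra.comulAlgHom k H)

theorem comulZero_apply (h : H) : C.comulZero h =
    DGA.tensorMapZero C.dga C.dga C.ofAlg C.ofAlg C.ofAlg_mem (Coalgebra.comul (R := k) h) := rfl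

theorem comulZero_mem (h : H) : C.comulZero h ∈ (C.dga.tensor C.dga).gr 0 :=
  DGA.tensorMapZero_mem C.dga C.dga C.ofAlg C.ofAlg C.ofAlg_mem C.ofAlg_mem _

variable {C} (L : C.LeftCovariant) (R : C.RightCovariant)

/-- The sum `ω ↦ ω₀ ⊗ ω₁ + ω₋₁ ⊗ ω₀` of the right and the left coaction, as a map
`Γ → Γ^∧ ⊗ Γ^∧`. -/
noncomputable def comulForm : Γ →ₗ[k] C.dga.Tensor C.dga :=
  (GradedTensorProduct.of k C.dga.gr C.dga.gr).toLinearMap ∘ₗ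
    (TensorProduct.map C.ofForm C.ofAlg.toLinearMap ∘ₗ R.coact +
      TensorProduct.map C.ofAlg.toLinearMap C.ofForm ∘ₗ L.coact)

theorem comulForm_apply (ω : Γ) : comulForm L R ω =
    GradedTensorProduct.of k C.dga.gr C.dga.gr
      (TensorProduct.map C.ofForm C.ofAlg.toLinearMap (R.coact ω)) +
    GradedTensorProduct.of k C.dga.gr C.dga.gr
      (TensorProduct.map C.ofAlg.toLinearMap C.ofForm (L.coact ω)) := by
  rw [← map_add]; rfl

theorem comulForm_smul (a : H) (ω : Γ) :
    comulForm L R (a • ω) = C.comulZero a * comulForm L R ω := by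
  rw [comulForm_apply, comulForm_apply, L.coact_smul, R.coact_smul, comulZero_apply, mul_add]
  generalize Coalgebra.comul (R := k) a = s
  generalize L.coact ω = t
  generalize R.coact ω = u
  congr 1
  · induction s with
    | zero => simp
    | add x y hx hy => simp only [map_add, LinearMap.add_apply, add_mul, hx, hy]
    | tmul a b =>
      induction u with
      | zero => simp
      | add x y hx hy => simp only [map_add, mul_add, hx, hy]
      | tmul ω h =>
        simp only [TensorProduct.map₂_apply_tmul, TensorProduct.map_tmul, lact_apply,
          LinearMap.mul_apply', AlgHom.toLinearMap_apply, ofForm_smul, map_mul]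
        exact (DGA.tmul_mul_tmul_of_left C.dga C.dga _ _ (C.ofAlg_mem b) _).symm
  · induction s with
    | zero => simp
    | add x y hx hy => simp only [map_add, LinearMap.add_apply, add_mul, hx, hy]
    | tmul a b =>
      induction t with
      | zero => simp
      | add x y hx hy => simp only [map_add, mul_add, hx, hy]
      | tmul h ω =>
        simp only [TensorProduct.map₂_apply_tmul, TensorProduct.map_tmul, lact_apply,
          LinearMap.mul_apply', AlgHom.toLinearMap_apply, ofForm_smul, map_mul]
        exact (DGA.tmul_mul_tmul_of_left C.dga C.dga _ _ (C.ofAlg_mem b) _).symm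

theorem comulForm_op_smul (a : H) (ω : Γ) :
    comulForm L R (MulOpposite.op a • ω) = comulForm L R ω * C.comulZero a := by
  rw [comulForm_apply, comulForm_apply, L.coact_op_smul, R.coact_op_smul, comulZero_apply, add_mul]
  generalize Coalgebra.comul (R := k) a = s
  generalize L.coact ω = t
  generalize R.coact ω = u
  congr 1
  · induction s with
    | zero => simp
    | add x y hx hy => simp only [map_add, mul_add, hx, hy]
    | tmul a b =>
      induction u with
      | zero => simp
      | add x y hx hy => simp only [map_add, LinearMap.add_apply, add_mul, hx, hy]
      | tmul ω h =>
        simp only [TensorProduct.map₂_apply_tmul, TensorProduct.map_tmul, ract_apply,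
          LinearMap.mul_apply', AlgHom.toLinearMap_apply, ofForm_op_smul, map_mul]
        exact (DGA.tmul_mul_tmul_of_right C.dga C.dga _ _ (C.ofAlg_mem a) _).symm
  · induction s with
    | zero => simp
    | add x y hx hy => simp only [map_add, mul_add, hx, hy]
    | tmul a b =>
      induction t with
      | zero => simp
      | add x y hx hy => simp only [map_add, LinearMap.add_apply, add_mul, hx, hy]
      | tmul h ω =>
        simp only [TensorProduct.map₂_apply_tmul, TensorProduct.map_tmul, ract_apply,
          LinearMap.mul_apply', AlgHom.toLinearMap_apply, ofForm_op_smul, map_mul]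
        exact (DGA.tmul_mul_tmul_of_right C.dga C.dga _ _ (C.ofAlg_mem a) _).symm

theorem comulForm_d (a : H) :
    comulForm L R (C.d a) = (C.dga.tensor C.dga).d (C.comulZero a) := by
  have e : C.dga.d ∘ₗ C.ofAlg.toLinearMap = C.ofForm ∘ₗ C.d :=
    LinearMap.ext fun a => C.dMax_ofAlg a
  refine Eq.trans ?_ (DGA.tensorD_tensorMapZero C.dga C.dga C.ofAlg C.ofAlg C.ofAlg_mem
    (Coalgebra.comul (R := k) a)).symm
  rw [comulForm_apply, R.coact_d, L.coact_d, e, map_add]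
  generalize Coalgebra.comul (R := k) a = s
  congr 2
  · rw [← LinearMap.comp_apply, LinearMap.map_comp_rTensor]
  · rw [← LinearMap.comp_apply, LinearMap.map_comp_lTensor]

/-- The coproduct `Γ^∧ → Γ^∧ ⊗ Γ^∧` of the maximal prolongation: the algebra map that extends the
coproduct of `H` and is the sum of the two coactions on `Γ`. -/
noncomputable def comulAlg : C.MaxProl →ₐ[k] C.dga.Tensor C.dga :=
  C.lift C.comulZero (comulForm L R) (comulForm_smul L R) (comulForm_op_smul L R) (by
    intro n a b h
    -- Applying `d` to `∑ Δ(aᵢ) dΔ(bᵢ) = 0` gives the relation.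
    have h1 : ∑ i, C.comulZero (a i) * comulForm L R (C.d (b i)) = 0 := by
      simp only [← comulForm_smul, ← map_sum, h, map_zero]
    have h2 := congr((C.dga.tensor C.dga).d $h1)
    rw [map_sum, map_zero] at h2
    rw [← h2]
    refine Finset.sum_congr rfl fun i _ => ?_
    rw [(C.dga.tensor C.dga).leibniz (C.comulZero_mem (a i)), comulForm_d, comulForm_d,
      (C.dga.tensor C.dga).d_d, mul_zero, smul_zero, add_zero])

/-- The coproduct of the maximal prolongation of a bicovariant calculus, as a morphism of
differential graded algebras. -/
noncomputable def comulHom : C.dga.Hom (C.dga.tensor C.dga) :=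
  C.dga_isCalculus.hom (C.dga.tensor C.dga) (comulAlg L R)
    (fun a => by rw [comulAlg, lift_ofAlg]; exact C.comulZero_mem a)
    (fun a => by
      change comulAlg L R (C.dMax (C.ofAlg a)) = _
      rw [dMax_ofAlg, comulAlg, lift_ofForm, lift_ofAlg, comulForm_d])

theorem comulHom_ofAlg (a : H) : (comulHom L R).toAlgHom (C.ofAlg a) = C.comulZero a := by
  change comulAlg L R (C.ofAlg a) = _
  rw [comulAlg, lift_ofAlg]

end FODC
end NCG

/-! ### The coaction on vertical forms -/

namespace NCG
namespace Vert

variable {k A H Γ : Type*} [Field k] [Ring A] [Algebra k A] [Ring H] [HopfAlgebra k H]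
    [AddCommGroup Γ] [Module k Γ]
    [Module H Γ] [Module Hᵐᵒᵖ Γ] [SMulCommClass H Hᵐᵒᵖ Γ] [IsScalarTower k H Γ]
    [IsScalarTower k Hᵐᵒᵖ Γ] {C : FODC k H Γ} (ρ : ComoduleAlgebra k A H) (L : C.LeftCovariant)
    (R : C.RightCovariant)

/-- The embedding `a ⊗ θ ↦ a₀ ⊗ a₁ θ` of the vertical forms in `A ⊗ Γ^∧`, as an algebra map. -/
noncomputable def toPHom : Vert ρ L →ₐ[k] A ⊗[k] C.MaxProl :=
  AlgHom.ofLinearMap (toP ρ L) (toP_one ρ L) (toP_mul ρ L)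

theorem toP_mem {n : ℕ} {v : Vert ρ L} (hv : v ∈ gr ρ L n) :
    toP ρ L v ∈ LinearMap.range ((C.grMax n).subtype.lTensor A) := by
  induction hv using gr_induction with
  | h0 => simp
  | hadd x y _ _ hx hy => rw [map_add]; exact add_mem hx hy
  | h a θ hθ =>
    change emb ρ L (a ⊗ₜ θ) ∈ _
    rw [emb_tmul, coactP_apply]
    generalize ρ.coact a = t
    induction t with
    | zero => simp
    | add x y hx hy => rw [map_add, add_mul]; exact add_mem hx hy
    | tmul a b =>
      have h := C.mul_mem_grMax (C.ofAlg_mem b) hθ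
      rw [zero_add] at h
      exact ⟨a ⊗ₜ ⟨_, h⟩, by simp⟩

variable (A C) in
/-- Reassociation, as a map from `(A ⊗ Γ^∧) ⊗ Γ^∧` to the algebra `A ⊗ (Γ^∧ ⊗ Γ^∧)`. -/
noncomputable def reassoc :
    (A ⊗[k] C.MaxProl) ⊗[k] C.MaxProl ≃ₗ[k] A ⊗[k] C.dga.Tensor C.dga :=
  (TensorProduct.assoc k A C.MaxProl C.MaxProl).trans
    (LinearEquiv.lTensor A (GradedTensorProduct.of k C.dga.gr C.dga.gr))

@[simp] theorem reassoc_tmul (a : A) (x y : C.MaxProl) :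
    reassoc A C ((a ⊗ₜ x) ⊗ₜ y) = a ⊗ₜ (x ᵍ⊗ₜ[k] y) := rfl

/-- Up to the sign of the graded tensor product, reassociation is multiplicative. -/
theorem reassoc_mul {i j : ℕ} (p : A ⊗[k] C.MaxProl) {x : C.MaxProl} (hx : x ∈ C.grMax j)
    {q : A ⊗[k] C.MaxProl} (hq : q ∈ LinearMap.range ((C.grMax i).subtype.lTensor A))
    (y : C.MaxProl) : reassoc A C ((p * q) ⊗ₜ (x * y)) =
      (-1 : k) ^ (j * i) • (reassoc A C (p ⊗ₜ x) * reassoc A C (q ⊗ₜ y)) := by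
  have hs : (-1 : k) ^ (j * i) * (-1 : k) ^ (j * i) = 1 := by rw [← mul_pow]; simp
  obtain ⟨q, rfl⟩ := hq
  induction p with
  | zero => simp
  | add p p' hp hp' =>
    simp only [add_mul, TensorProduct.add_tmul, map_add, smul_add, hp, hp']
  | tmul a x' =>
    induction q with
    | zero => simp
    | add p p' hp hp' =>
      simp only [mul_add, TensorProduct.add_tmul, map_add, smul_add, hp, hp']
    | tmul b z =>
      simp only [LinearMap.lTensor_tmul, Submodule.subtype_apply,
        Algebra.TensorProduct.tmul_mul_tmul, reassoc_tmul]
      have h := DGA.tmul_mul_tmul C.dga C.dga x' hx z.2 y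
      rw [h, TensorProduct.tmul_smul, smul_smul, hs, one_smul]

/-- The embedding `v ⊗ x ↦ toP v ⊗ x` of `ver^•(A) ⊗ Γ^∧` in `A ⊗ (Γ^∧ ⊗ Γ^∧)`, as an algebra
map. -/
noncomputable def tensorToP : (dga ρ L).Tensor C.dga →ₐ[k] A ⊗[k] C.dga.Tensor C.dga :=
  AlgHom.ofLinearMap ((reassoc A C).toLinearMap ∘ₗ (toP ρ L).rTensor C.MaxProl ∘ₗ
      (GradedTensorProduct.of k (dga ρ L).gr C.dga.gr).symm.toLinearMap)
    (by
      change reassoc A C (toP ρ L 1 ⊗ₜ 1) = 1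
      rw [toP_one]; rfl)
    (DGA.tensor_map_mul _ _ _ (by
      intro i j v w x y hx hw
      change reassoc A C (toP ρ L (v * w) ⊗ₜ (x * y)) =
        (-1 : k) ^ (j * i) • (reassoc A C (toP ρ L v ⊗ₜ x) * reassoc A C (toP ρ L w ⊗ₜ y))
      rw [toP_mul]
      exact reassoc_mul _ hx (toP_mem ρ L hw) y))

theorem tensorToP_tmul (v : Vert ρ L) (x : C.MaxProl) :
    tensorToP ρ L (v ᵍ⊗ₜ[k] x) = reassoc A C (toP ρ L v ⊗ₜ x) := rfl

theorem tensorToP_injective : Function.Injective (tensorToP ρ L) := by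
  change Function.Injective (reassoc A C ∘ (toP ρ L).rTensor C.MaxProl ∘
    (GradedTensorProduct.of k (dga ρ L).gr C.dga.gr).symm)
  exact (reassoc A C).injective.comp
    ((Module.Flat.rTensor_preserves_injective_linearMap _ (toP_injective ρ L)).comp
      (LinearEquiv.injective _))

/-- The coaction of `A`, as a map `A → ver^•(A) ⊗ Γ^∧`. -/
noncomputable def coactZero : A →ₐ[k] (dga ρ L).Tensor C.dga :=
  (DGA.tensorMapZero (dga ρ L) C.dga (ofAlg ρ L) C.ofAlg (ofAlg_mem ρ L)).comp ρ.coact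

theorem coactZero_apply (a : A) : coactZero ρ L a =
    DGA.tensorMapZero (dga ρ L) C.dga (ofAlg ρ L) C.ofAlg (ofAlg_mem ρ L) (ρ.coact a) := rfl

theorem coactZero_mem (a : A) : coactZero ρ L a ∈ ((dga ρ L).tensor C.dga).gr 0 :=
  DGA.tensorMapZero_mem _ _ _ _ (ofAlg_mem ρ L) C.ofAlg_mem _

/-- The map `(id ⊗ Δ^∧) ∘ toP` from `ver^•(A)` to `A ⊗ (Γ^∧ ⊗ Γ^∧)`, with `Δ^∧` the coproduct of
`Γ^∧`. -/
noncomputable def comulToP : Vert ρ L →ₐ[k] A ⊗[k] C.dga.Tensor C.dga :=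
  (Algebra.TensorProduct.map (AlgHom.id k A) (FODC.comulHom L R).toAlgHom).comp (toPHom ρ L)

/-- On `A` both maps are `a ↦ a₀ ⊗ (a₁ ⊗ a₂)`. -/
theorem comulToP_ofAlg (a : A) :
    comulToP ρ L R (ofAlg ρ L a) = tensorToP ρ L (coactZero ρ L a) := by
  have e1 : ∀ t : A ⊗[k] H, Algebra.TensorProduct.map (AlgHom.id k A)
      (FODC.comulHom L R).toAlgHom (C.ofAlg.toLinearMap.lTensor A t) =
      (DGA.tensorMapZero C.dga C.dga C.ofAlg C.ofAlg C.ofAlg_mem).toLinearMap.lTensor A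
        ((Coalgebra.comul (R := k) (A := H)).lTensor A t) := by
    intro t
    induction t with
    | zero => simp
    | add x y hx hy => simp only [map_add, hx, hy]
    | tmul a h =>
      simp only [LinearMap.lTensor_tmul, Algebra.TensorProduct.map_tmul, AlgHom.toLinearMap_apply,
        FODC.comulHom_ofAlg, AlgHom.id_apply]
      rfl
  have e2 : ∀ t : A ⊗[k] H, tensorToP ρ L
      (DGA.tensorMapZero (dga ρ L) C.dga (ofAlg ρ L) C.ofAlg (ofAlg_mem ρ L) t) =
      (DGA.tensorMapZero C.dga C.dga C.ofAlg C.ofAlg C.ofAlg_mem).toLinearMap.lTensor A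
        (TensorProduct.assoc k A H H (ρ.coact.toLinearMap.rTensor H t)) := by
    intro t
    induction t with
    | zero => simp
    | add x y hx hy => simp only [map_add, hx, hy]
    | tmul a h =>
      change reassoc A C (toP ρ L (ofAlg ρ L a) ⊗ₜ C.ofAlg h) = _
      rw [toP_ofAlg, coactP_apply, LinearMap.rTensor_tmul, AlgHom.toLinearMap_apply]
      generalize ρ.coact a = s
      induction s with
      | zero => simp
      | add x y hx hy => simp only [map_add, TensorProduct.add_tmul, hx, hy]
      | tmul b g => rfl
  rw [coactZero_apply, e2, ρ.coassoc, ← e1, ← coactP_apply, ← toP_ofAlg (L := L)]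
  rfl

theorem comulToP_d (v : Vert ρ L) : comulToP ρ L R ((dga ρ L).d v) =
    (C.dga.tensor C.dga).d.lTensor A (comulToP ρ L R v) := by
  have e : ∀ t : A ⊗[k] C.MaxProl, Algebra.TensorProduct.map (AlgHom.id k A)
      (FODC.comulHom L R).toAlgHom (C.dMax.lTensor A t) = (C.dga.tensor C.dga).d.lTensor A
        (Algebra.TensorProduct.map (AlgHom.id k A) (FODC.comulHom L R).toAlgHom t) := by
    intro t
    induction t with
    | zero => simp
    | add x y hx hy => simp only [map_add, hx, hy]
    | tmul a x =>
      simp only [LinearMap.lTensor_tmul, Algebra.TensorProduct.map_tmul]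
      rw [← (FODC.comulHom L R).map_d]
      rfl
  refine Eq.trans ?_ (e (toP ρ L v))
  rw [← toP_d]
  rfl

theorem tensorToP_d_coactZero (a : A) :
    tensorToP ρ L (((dga ρ L).tensor C.dga).d (coactZero ρ L a)) =
      (C.dga.tensor C.dga).d.lTensor A (tensorToP ρ L (coactZero ρ L a)) := by
  rw [coactZero_apply]
  generalize ρ.coact a = t
  induction t with
  | zero => simp
  | add x y hx hy => simp only [map_add, hx, hy]
  | tmul a h =>
    have h1 := DGA.tensorD_tmul (dga ρ L) C.dga (ofAlg_mem ρ L a) (C.ofAlg h)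
    rw [pow_zero, one_smul] at h1
    have h2 : DGA.tensorMapZero (dga ρ L) C.dga (ofAlg ρ L) C.ofAlg (ofAlg_mem ρ L) (a ⊗ₜ h) =
      ofAlg ρ L a ᵍ⊗ₜ[k] C.ofAlg h := rfl
    have h3 : ((dga ρ L).tensor C.dga).d (ofAlg ρ L a ᵍ⊗ₜ[k] C.ofAlg h) =
      (dga ρ L).d (ofAlg ρ L a) ᵍ⊗ₜ[k] C.ofAlg h + ofAlg ρ L a ᵍ⊗ₜ[k] C.dga.d (C.ofAlg h) := h1
    have h4 : toP ρ L ((dga ρ L).d (ofAlg ρ L a)) =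
      C.dMax.lTensor A (toP ρ L (ofAlg ρ L a)) := toP_d ρ L _
    rw [h2, h3, map_add, tensorToP_tmul, tensorToP_tmul, tensorToP_tmul, h4, toP_ofAlg,
      coactP_apply]
    generalize ρ.coact a = s
    induction s with
    | zero => simp
    | add x y hx hy =>
      simp only [map_add, TensorProduct.add_tmul] at hx hy ⊢
      rw [← hx, ← hy]
      abel
    | tmul b g =>
      have h5 := DGA.tensorD_tmul C.dga C.dga (C.ofAlg_mem g) (C.ofAlg h)
      rw [pow_zero, one_smul] at h5
      simp only [LinearMap.lTensor_tmul, reassoc_tmul, ← TensorProduct.tmul_add]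
      exact congrArg (b ⊗ₜ[k] ·) h5.symm

theorem comulToP_d_ofAlg (a : A) : comulToP ρ L R ((dga ρ L).d (ofAlg ρ L a)) =
    tensorToP ρ L (((dga ρ L).tensor C.dga).d (coactZero ρ L a)) := by
  rw [comulToP_d, comulToP_ofAlg, tensorToP_d_coactZero]

/-- The vertical forms are generated by `A` and `d A`, so it is enough that their images lie in
`ver^•(A) ⊗ Γ^∧`. -/
theorem comulToP_mem (hρ : Function.Surjective ρ.canonicalMap) (v : Vert ρ L) :
    comulToP ρ L R v ∈ (tensorToP ρ L).range :=
  (isCalculus ρ L hρ).map_mem_subalgebra (comulToP ρ L R) (tensorToP ρ L).range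
    (fun a => ⟨_, (comulToP_ofAlg ρ L R a).symm⟩) (fun a => ⟨_, (comulToP_d_ofAlg ρ L R a).symm⟩) v

/-- The coaction `ver^•(A) → ver^•(A) ⊗ Γ^∧`, as an algebra map: the factorization of
`(id ⊗ Δ^∧) ∘ toP` through the embedding of `ver^•(A) ⊗ Γ^∧`. -/
noncomputable def coactAlg (hρ : Function.Surjective ρ.canonicalMap) :
    Vert ρ L →ₐ[k] (dga ρ L).Tensor C.dga :=
  (AlgEquiv.ofInjective (tensorToP ρ L) (tensorToP_injective ρ L)).symm.toAlgHom.comp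
    ((comulToP ρ L R).codRestrict _ (comulToP_mem ρ L R hρ))

theorem tensorToP_coactAlg (hρ : Function.Surjective ρ.canonicalMap) (v : Vert ρ L) :
    tensorToP ρ L (coactAlg ρ L R hρ v) = comulToP ρ L R v :=
  congrArg Subtype.val ((AlgEquiv.ofInjective (tensorToP ρ L)
    (tensorToP_injective ρ L)).apply_symm_apply ⟨_, comulToP_mem ρ L R hρ v⟩)

theorem coactAlg_ofAlg (hρ : Function.Surjective ρ.canonicalMap) (a : A) :
    coactAlg ρ L R hρ (ofAlg ρ L a) = coactZero ρ L a :=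
  tensorToP_injective ρ L (by rw [tensorToP_coactAlg, comulToP_ofAlg])

/-- The coaction on vertical forms, as a morphism of differential graded algebras. -/
noncomputable def coactHom (hρ : Function.Surjective ρ.canonicalMap) :
    (dga ρ L).Hom ((dga ρ L).tensor C.dga) :=
  (isCalculus ρ L hρ).hom _ (coactAlg ρ L R hρ)
    (fun a => by rw [coactAlg_ofAlg]; exact coactZero_mem ρ L a)
    (fun a => tensorToP_injective ρ L (by
      rw [tensorToP_coactAlg, coactAlg_ofAlg, comulToP_d_ofAlg]))

theorem extendsCoact_coactHom (hρ : Function.Surjective ρ.canonicalMap) :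
    ExtendsCoact ρ (ofAlg ρ L) (coactHom ρ L R hρ) :=
  coactAlg_ofAlg ρ L R hρ

end Vert
end NCG

/-! ### The vertical projection -/

namespace NCG

variable {k A H Γ : Type*} [Field k] [Ring A] [Algebra k A] [Ring H] [HopfAlgebra k H]
    [AddCommGroup Γ] [Module k Γ]
    [Module H Γ] [Module Hᵐᵒᵖ Γ] [SMulCommClass H Hᵐᵒᵖ Γ] [IsScalarTower k H Γ]
    [IsScalarTower k Hᵐᵒᵖ Γ] {C : FODC k H Γ} (ρ : ComoduleAlgebra k A H) (L : C.LeftCovariant)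

section
variable {Ω : Type*} [Ring Ω] [Algebra k Ω] {D : DGA k Ω} {ι : A →ₐ[k] Ω}

namespace DGA.IsCalculus

theorem algebra_proj₀ (h : D.IsCalculus ι) (ω : Ω) : ι (h.proj₀ ω) = D.proj 0 ω := by
  have := (LinearEquiv.ofBijective (ι.toLinearMap.codRestrict (D.gr 0) fun a => by
      rw [← h.range]; exact ⟨a, rfl⟩)
    ⟨fun a b hab => h.injective congr(($hab : Ω)), fun ω => by
      obtain ⟨a, ha⟩ : (ω : Ω) ∈ LinearMap.range ι.toLinearMap := by rw [h.range]; exact ω.2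
      exact ⟨a, Subtype.ext ha⟩⟩).apply_symm_apply ⟨D.proj 0 ω, D.proj_mem 0 ω⟩
  exact congrArg Subtype.val this

theorem proj₀_algebra (h : D.IsCalculus ι) (a : A) : h.proj₀ (ι a) = a :=
  h.injective (by rw [h.algebra_proj₀, D.proj_of_mem (h.algebra_mem a)])

theorem proj₀_of_mem_succ (h : D.IsCalculus ι) {n : ℕ} {ω : Ω} (hω : ω ∈ D.gr (n + 1)) :
    h.proj₀ ω = 0 :=
  h.injective (by rw [h.algebra_proj₀, D.proj_of_mem_ne hω (Nat.succ_ne_zero n), map_zero])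

/-- The projection to degree zero is multiplicative, since degrees are non-negative. -/
theorem proj₀_mul (h : D.IsCalculus ι) (ω η : Ω) : h.proj₀ (ω * η) = h.proj₀ ω * h.proj₀ η := by
  have key : ∀ (n : ℕ) (ω : Ω), ω ∈ D.gr n → ω ∈ D.gr 0 ∨ ∃ m, ω ∈ D.gr (m + 1) := by
    rintro (_ | n) ω hω
    · exact .inl hω
    · exact .inr ⟨n, hω⟩
  induction ω using D.induction with
  | h0 => simp
  | hadd x y hx hy => simp only [add_mul, map_add, hx, hy]
  | h m x hx =>
    induction η using D.induction with
    | h0 => simp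
    | hadd x y hx hy => simp only [mul_add, map_add, hx, hy]
    | h n y hy =>
      have hxy : x * y ∈ D.gr (m + n) := SetLike.GradedMul.mul_mem hx hy
      cases m with
      | zero =>
        cases n with
        | zero =>
          rw [← h.range] at hx hy
          obtain ⟨a, rfl⟩ := hx
          obtain ⟨b, rfl⟩ := hy
          simp only [AlgHom.toLinearMap_apply, ← map_mul, h.proj₀_algebra]
        | succ n =>
          rw [← add_assoc] at hxy
          rw [h.proj₀_of_mem_succ hxy, h.proj₀_of_mem_succ hy, mul_zero]
      | succ m =>
        rw [add_right_comm] at hxy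
        rw [h.proj₀_of_mem_succ hxy, h.proj₀_of_mem_succ hx, zero_mul]

variable (C) in
/-- The projection `Ω ⊗ Γ^∧ → Ω^0 ⊗ Γ^∧ = A ⊗ Γ^∧`, as an algebra map. -/
noncomputable def tensorProj₀ (h : D.IsCalculus ι) : D.Tensor C.dga →ₐ[k] A ⊗[k] C.MaxProl :=
  AlgHom.ofLinearMap (h.proj₀.rTensor C.MaxProl ∘ₗ
      (GradedTensorProduct.of k D.gr C.dga.gr).symm.toLinearMap)
    (by
      change h.proj₀ 1 ⊗ₜ 1 = 1
      rw [← map_one ι, h.proj₀_algebra]; rfl)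
    (DGA.tensor_map_mul _ _ _ (by
      intro i j ω η x y _ hη
      change h.proj₀ (ω * η) ⊗ₜ (x * y) =
        (-1 : k) ^ (j * i) • (h.proj₀ ω ⊗ₜ x * h.proj₀ η ⊗ₜ y)
      rw [h.proj₀_mul, Algebra.TensorProduct.tmul_mul_tmul]
      -- The sign is trivial in degree zero, and both sides vanish in positive degree.
      cases i with
      | zero => rw [mul_zero, pow_zero, one_smul]
      | succ i => rw [h.proj₀_of_mem_succ hη]; simp))

theorem tensorProj₀_tmul (h : D.IsCalculus ι) (ω : Ω) (x : C.MaxProl) :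
    h.tensorProj₀ C (ω ᵍ⊗ₜ[k] x) = h.proj₀ ω ⊗ₜ x := rfl

end DGA.IsCalculus

/-- `f ⊗ id`, for a morphism `f` of differential graded algebras, as an algebra map. -/
noncomputable def mapTensorIdHom {Ω' : Type*} [Ring Ω'] [Algebra k Ω'] {D' : DGA k Ω'}
    (f : D.Hom D') : D.Tensor C.dga →ₐ[k] D'.Tensor C.dga :=
  AlgHom.ofLinearMap (mapTensorId D D' f.toAlgHom.toLinearMap)
    (by
      change f.toAlgHom 1 ᵍ⊗ₜ[k] 1 = _
      rw [map_one]; rfl)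
    (DGA.tensor_map_mul _ _ _ (by
      intro i j ω η x y hx hη
      change f.toAlgHom (ω * η) ᵍ⊗ₜ[k] (x * y) =
        (-1 : k) ^ (j * i) • (f.toAlgHom ω ᵍ⊗ₜ[k] x * f.toAlgHom η ᵍ⊗ₜ[k] y)
      have hs : (-1 : k) ^ (j * i) * (-1 : k) ^ (j * i) = 1 := by rw [← mul_pow]; simp
      have h := DGA.tmul_mul_tmul D' C.dga (f.toAlgHom ω) hx (f.map_mem hη) y
      rw [h, smul_smul, hs, one_smul, map_mul]))

theorem mapTensorIdHom_d {Ω' : Type*} [Ring Ω'] [Algebra k Ω'] {D' : DGA k Ω'} (f : D.Hom D')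
    (t : D.Tensor C.dga) : mapTensorIdHom f ((D.tensor C.dga).d t) =
      (D'.tensor C.dga).d (mapTensorIdHom f t) := by
  obtain ⟨t, rfl⟩ := (GradedTensorProduct.of k D.gr C.dga.gr).surjective t
  induction t with
  | zero => simp
  | add x y hx hy => simp only [map_add, hx, hy]
  | tmul ω x =>
    induction ω using D.induction with
    | h0 => simp
    | hadd x y hx hy => simp only [TensorProduct.add_tmul, map_add, hx, hy]
    | h n ω hω =>
      have h1 : (D.tensor C.dga).d (GradedTensorProduct.of k D.gr C.dga.gr (ω ⊗ₜ x)) =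
        D.d ω ᵍ⊗ₜ[k] x + (-1 : k) ^ n • (ω ᵍ⊗ₜ[k] C.dga.d x) := DGA.tensorD_tmul D C.dga hω x
      have h2 : (D'.tensor C.dga).d (f.toAlgHom ω ᵍ⊗ₜ[k] x) =
        D'.d (f.toAlgHom ω) ᵍ⊗ₜ[k] x + (-1 : k) ^ n • (f.toAlgHom ω ᵍ⊗ₜ[k] C.dga.d x) :=
          DGA.tensorD_tmul D' C.dga (f.map_mem hω) x
      have h3 : ∀ (ω : Ω) (x : C.MaxProl),
        mapTensorIdHom f (ω ᵍ⊗ₜ[k] x : D.Tensor C.dga) = f.toAlgHom ω ᵍ⊗ₜ[k] x := fun _ _ => rfl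
      rw [h1, map_add, map_smul, h3, h3, f.map_d, ← h2]
      rfl

variable {ρ} in
theorem ExtendsCoact.tensorProj₀ (h : D.IsCalculus ι) {Δ : D.Hom (D.tensor C.dga)}
    (hΔ : ExtendsCoact ρ ι Δ) (a : A) :
    h.tensorProj₀ C (Δ.toAlgHom (ι a)) = Vert.toP ρ L (Vert.ofAlg ρ L a) := by
  rw [hΔ, Vert.toP_ofAlg, Vert.coactP_apply]
  generalize ρ.coact a = t
  induction t with
  | zero => simp
  | add x y hx hy => simp only [map_add, hx, hy]
  | tmul a b =>
    change h.proj₀ (ι a) ⊗ₜ C.ofAlg b = _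
    rw [h.proj₀_algebra]; rfl

variable {ρ} in
theorem ExtendsCoact.tensorProj₀_d (h : D.IsCalculus ι) {Δ : D.Hom (D.tensor C.dga)}
    (hΔ : ExtendsCoact ρ ι Δ) (a : A) :
    h.tensorProj₀ C (Δ.toAlgHom (D.d (ι a))) =
      Vert.toP ρ L ((Vert.dga ρ L).d (Vert.ofAlg ρ L a)) := by
  refine Eq.trans ?_ (Vert.toP_d ρ L _).symm
  rw [Δ.map_d, hΔ, Vert.toP_ofAlg, Vert.coactP_apply]
  generalize ρ.coact a = t
  induction t with
  | zero => simp
  | add x y hx hy => simp only [map_add, hx, hy]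
  | tmul a b =>
    have h1 : (D.tensor C.dga).d (ι a ᵍ⊗ₜ[k] C.ofAlg b) =
      D.d (ι a) ᵍ⊗ₜ[k] C.ofAlg b + (-1 : k) ^ 0 • (ι a ᵍ⊗ₜ[k] C.dga.d (C.ofAlg b)) :=
        DGA.tensorD_tmul D C.dga (h.algebra_mem a) _
    refine (congrArg (h.tensorProj₀ C) h1).trans ?_
    rw [map_add, pow_zero, one_smul, h.tensorProj₀_tmul, h.tensorProj₀_tmul,
      h.proj₀_of_mem_succ (D.d_mem (h.algebra_mem a)), h.proj₀_algebra, TensorProduct.zero_tmul,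
      zero_add]
    rfl

variable {ρ} in
/-- The image of the vertical projection of `ω` in `A ⊗ Γ^∧` is the component of `Δ ω` in
`Ω^0 ⊗ Γ^∧`. -/
theorem ExtendsCoact.toP_piVer (h : D.IsCalculus ι) {Δ : D.Hom (D.tensor C.dga)}
    (hΔ : ExtendsCoact ρ ι Δ) (ω : Ω) :
    Vert.toP ρ L (piVer ρ L h Δ ω) = h.tensorProj₀ C (Δ.toAlgHom ω) := by
  obtain ⟨v, hv⟩ := h.map_mem_subalgebra ((h.tensorProj₀ C).comp Δ.toAlgHom)
    (Vert.toPHom ρ L).range (fun a => ⟨_, (hΔ.tensorProj₀ L h a).symm⟩)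
    (fun a => ⟨_, (hΔ.tensorProj₀_d L h a).symm⟩) ω
  replace hv : Vert.toP ρ L v = h.tensorProj₀ C (Δ.toAlgHom ω) := hv
  have e : piVer ρ L h Δ ω = Vert.equiv ρ L (L.piInv.lTensor A
      (h.tensorProj₀ C (Δ.toAlgHom ω))) := by
    change Vert.equiv ρ L (TensorProduct.map h.proj₀ L.piInv _) =
      Vert.equiv ρ L (L.piInv.lTensor A (h.proj₀.rTensor C.MaxProl _))
    rw [← LinearMap.comp_apply (L.piInv.lTensor A), LinearMap.lTensor_comp_rTensor]
    rfl
  rw [e, ← hv, Vert.lTensor_piInv_toP]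

variable {ρ} in
/-- The vertical projection, as a morphism of differential graded algebras. -/
noncomputable def piVerHom (h : D.IsCalculus ι) {Δ : D.Hom (D.tensor C.dga)}
    (hΔ : ExtendsCoact ρ ι Δ) : D.Hom (Vert.dga ρ L) :=
  have h0 : ∀ a, piVer ρ L h Δ (ι a) = Vert.ofAlg ρ L a := fun a =>
    Vert.toP_injective ρ L (by rw [hΔ.toP_piVer, hΔ.tensorProj₀ L])
  h.hom (Vert.dga ρ L)
    (AlgHom.ofLinearMap (piVer ρ L h Δ)
      (by rw [← map_one ι, h0, map_one])
      (fun x y => Vert.toP_injective ρ L (by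
        rw [Vert.toP_mul, hΔ.toP_piVer, hΔ.toP_piVer, hΔ.toP_piVer, map_mul, map_mul])))
    (fun a => by
      change piVer ρ L h Δ (ι a) ∈ _
      rw [h0]; exact Vert.ofAlg_mem ρ L a)
    (fun a => by
      change piVer ρ L h Δ (D.d (ι a)) = (Vert.dga ρ L).d (piVer ρ L h Δ (ι a))
      rw [h0]
      exact Vert.toP_injective ρ L (by rw [hΔ.toP_piVer, hΔ.tensorProj₀_d L]))

end

end NCG

theorem mainTheorem3 {k A H Γ : Type*} [Field k] [Ring A] [Algebra k A]
    [Ring H] [HopfAlgebra k H] [AddCommGroup Γ] [Module k Γ] [Module H Γ] [Module Hᵐᵒᵖ Γ]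
    [SMulCommClass H Hᵐᵒᵖ Γ] [IsScalarTower k H Γ] [IsScalarTower k Hᵐᵒᵖ Γ]
    (C : FODC k H Γ) (L : C.LeftCovariant) (R : C.RightCovariant)
    (ρ : ComoduleAlgebra k A H) (hρ : ρ.IsPrincipalBundle) :
    (Vert.dga ρ L).IsComplete C ρ (Vert.ofAlg ρ L) ∧
    ∀ Δver : (Vert.dga ρ L).Hom ((Vert.dga ρ L).tensor C.dga),
      ExtendsCoact ρ (Vert.ofAlg ρ L) Δver →
      ∀ (Ω : Type*) [Ring Ω] [Algebra k Ω] (D : DGA k Ω) (ι : A →ₐ[k] Ω) (hD : D.IsCalculus ι)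
        (ΔA : D.Hom (D.tensor C.dga)), ExtendsCoact ρ ι ΔA →
        ∀ ω : Ω, Δver.toAlgHom (piVer ρ L hD ΔA ω) =
          mapTensorId D (Vert.dga ρ L) (piVer ρ L hD ΔA) (ΔA.toAlgHom ω) := by
  have hs := hρ.1.surjective
  refine ⟨⟨Vert.isCalculus ρ L hs, Vert.coactHom ρ L R hs, Vert.extendsCoact_coactHom ρ L R hs⟩, ?_⟩
  intro Δver hver Ω _ _ D ι hD ΔA hΔ ω
  let π := piVerHom L hD hΔ
  have hπ : ∀ a, π.toAlgHom (ι a) = Vert.ofAlg ρ L a := fun a =>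
    Vert.toP_injective ρ L ((hΔ.toP_piVer L hD _).trans (hΔ.tensorProj₀ L hD a))
  -- Both sides are morphisms of differential graded algebras that are `a ↦ a₀ ⊗ a₁` on `A`.
  have key : Δver.toAlgHom.comp π.toAlgHom = (mapTensorIdHom π).comp ΔA.toAlgHom := by
    refine hD.algHom_ext ((Vert.dga ρ L).tensor C.dga).d ?_ ?_ ?_
    · intro ω
      rw [AlgHom.comp_apply, AlgHom.comp_apply, π.map_d, Δver.map_d]
    · intro ω
      rw [AlgHom.comp_apply, AlgHom.comp_apply, ΔA.map_d, mapTensorIdHom_d]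
    · intro a
      rw [AlgHom.comp_apply, AlgHom.comp_apply, hπ, hver, hΔ]
      generalize ρ.coact a = t
      induction t with
      | zero => simp
      | add x y hx hy => simp only [map_add, hx, hy]
      | tmul a b =>
        change _ = π.toAlgHom (ι a) ᵍ⊗ₜ[k] C.ofAlg b
        rw [hπ]; rfl
  exact congr($key ω)
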